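/- Let $X\subseteq\mathbb R^d$ be closed and convex, let $f,r:\mathbb R^d\to\mathbb R$ be convex, $F=f+r$, and let $x_\star\in X$ satisfy $F_\star:=F(x_\star)=\min_{x\in X}F(x)$. For each $x\in X$ let $\nabla f(x)\in\partial f(x)$ be a fixed subgradient, and assume $\|\nabla f(x)\|\le G$ for all $x\in X$, where $G>0$. Let $\xi\sim\mathcal D$ be a random element of a measurable space $\Xi$ and let $g:X\times\Xi\to\mathbb R^d$ be jointly measurable with $\mathbb E[g(x,\xi)]=\nabla f(x)$ for all $x\in X$. Assume that for some $p\in(1,2]$ and constants with $0\le\sigma_s\le\sigma_l\le\sqrt{\pi d/2}\,\sigma_s$, $$\mathbb E\big|\langle e,g(x,\xi)-\nabla f(x)\rangle\big|^p\le\sigma_s^p,\qquad \mathbb E\|g(x,\xi)-\nabla f(x)\|^p\le\sigma_l^p\qquad\text{for all }x\in X,\ \|e\|=1.$$ Let $\delta\in(0,1]$, $x_1\in X$ and $D=\|x_\star-x_1\|>0$. Define $$d_{\rm eff}=\frac{\sigma_l^2}{\sigma_s^2},\qquad \varphi_\star=\max\Big\{\sqrt{d_{\rm eff}}\,\ln\tfrac3\delta,\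 d_{\rm eff}\mathbf 1[p<2]\Big\},\qquad \psi_\star=1+\ln\varphi_\star,$$ $$\tau_\star=\Big(\min\Big\{\frac{\sigma_s\sigma_l^{p-1}}{\ln(3/\delta)},\ \frac{\sigma_s^2}{\sigma_l^{2-p}\mathbf 1[p<2]}\Big\}\Big)^{1/p},$$ $$\gamma_\star=\frac{D/G}{\varphi_\star\psi_\star+\ln\frac3\delta},\qquad \eta_\star=\frac{D/G}{\sqrt{\sigma_l^p/G^p+1}},\qquad \lambda_\star=\frac{D}{\sqrt{\ln^2\frac3\delta+\frac{\sigma_l^p}{\tau_\star^p}+\frac{\sigma_s^2\sigma_l^{2p-2}}{\tau_\star^{2p}}}},$$ and, for $t\ge1$, $$\eta_t=\min\Big\{\gamma_\star,\ \frac{\eta_\star}{\sqrt t},\ \frac{\lambda_\star}{\tau_\star t^{1/p}}\Big\},\qquad \tau_t=\max\{2G,\ \tau_\star t^{1/p}\}.$$ For $p=2$ the second entry of the minimum in $\tau_\star$ is $+\infty$. In the noiseless case $\sigma_s=\sigma_l=0$ the conventions are $0/0=0$, $\tau_\star=0$, $\varphi_\star\psi_\star=0$ and $\lambda_\star/(\tau_\star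 t^{1/p})=+\infty$. Stabilized Clipped SGD draws independent samples $\xi_1,\xi_2,\dots\sim\mathcal D$ and iterates, for $t=1,2,\dots$, $$g_t^c=\min\Big\{1,\frac{\tau_t}{\|g(x_t,\xi_t)\|}\Big\}\,g(x_t,\xi_t),$$ $$x_{t+1}=\operatorname*{argmin}_{x\in X}\ r(x)+\langle g_t^c,x\rangle+\frac{\|x-x_t\|^2}{2\eta_t}+\frac{(\eta_t/\eta_{t+1}-1)\|x-x_1\|^2}{2\eta_t}.$$ (These parameters do not depend on a time horizon.) **Theorem.** There is an absolute constant $C>0$ such that, in the setting above, for every integer $T\ge1$, with probability at least $1-\delta$ the average $\bar x_{T+1}=\frac1T\sum_{t=1}^Tx_{t+1}$ satisfies $$F(\bar x_{T+1})-F_\star\le C\left(\frac{(\varphi_\star\psi_\star+\ln\frac3\delta)GD}{T}+\frac{(\sigma_l^{p/2}G^{1-p/2}+G)D}{\sqrt T}+\frac{\big(\sigma_s^{\frac2p-1}\sigma_l^{2-\frac2p}+\sigma_s^{\frac1p}\sigma_l^{1-\frac1p}\ln^{1-\frac1p}\frac3\delta\big)D}{T^{1-\frac1p}}\right).$$ 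-/

import Mathlib

open MeasureTheory ProbabilityTheory

noncomputable section

namespace StabilizedClippedSGD

/-- The vector `v` is a subgradient at `x` of the function `f`. -/
def IsSubgradientAt {d : ℕ} (f : EuclideanSpace ℝ (Fin d) → ℝ)
    (x v : EuclideanSpace ℝ (Fin d)) : Prop :=
  ∀ y, f x + inner ℝ v (y - x) ≤ f y

/-- The clipping function `clip_τ(g) = min {1, τ / ‖g‖} g` (with `clip_τ(0) = 0`). -/
def clip {d : ℕ} (τ : ℝ) (g : EuclideanSpace ℝ (Fin d)) : EuclideanSpace ℝ (Fin d) :=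
  min 1 (τ / ‖g‖) • g

/-- The stochastic first-order oracle: for every `x ∈ X`, the random vector `g x ξ` with `ξ ∼ P`
is an unbiased estimate of `f' x`. Its error has a `p`-th moment at most `σs ^ p` in each direction
and at most `σl ^ p` in norm, where `0 ≤ σs ≤ σl ≤ √(π d / 2) σs`.
The moments are integrals of nonnegative functions, with values in `[0, ∞]`. -/
structure IsHeavyTailedOracle {d : ℕ} {Ξ : Type*} [MeasurableSpace Ξ]
    (X : Set (EuclideanSpace ℝ (Fin d)))
    (f' : EuclideanSpace ℝ (Fin d) → EuclideanSpace ℝ (Fin d))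
    (g : EuclideanSpace ℝ (Fin d) → Ξ → EuclideanSpace ℝ (Fin d))
    (P : Measure Ξ) (p σs σl : ℝ) : Prop where
  measurable : Measurable fun z : X × Ξ => g z.1 z.2
  integrable : ∀ x ∈ X, Integrable (g x) P
  unbiased : ∀ x ∈ X, ∫ ξ, g x ξ ∂P = f' x
  one_lt_p : 1 < p
  p_le_two : p ≤ 2
  moment_inner : ∀ x ∈ X, ∀ e : EuclideanSpace ℝ (Fin d), ‖e‖ = 1 →
    ∫⁻ ξ, ENNReal.ofReal (|inner ℝ e (g x ξ - f' x)| ^ p) ∂P ≤ ENNReal.ofReal (σs ^ p)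
  moment_norm : ∀ x ∈ X,
    ∫⁻ ξ, ENNReal.ofReal (‖g x ξ - f' x‖ ^ p) ∂P ≤ ENNReal.ofReal (σl ^ p)
  σs_nonneg : 0 ≤ σs
  σs_le_σl : σs ≤ σl
  σl_le : σl ≤ √(Real.pi * d / 2) * σs

/-- Iterates `x 1, x 2, …` of Stabilized Clipped SGD, along every sample path `ω`, started at `x₁`,
run with stepsizes `η t`, clipping thresholds `τ t` and samples `ξ t`, where `t ≥ 1`.
The values `x 0`, `η 0`, `τ 0` and `ξ 0` play no role. -/
structure IsStabilizedClippedSGD {d : ℕ} {Ξ Ω : Type*}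
    (X : Set (EuclideanSpace ℝ (Fin d))) (r : EuclideanSpace ℝ (Fin d) → ℝ)
    (g : EuclideanSpace ℝ (Fin d) → Ξ → EuclideanSpace ℝ (Fin d))
    (x₁ : EuclideanSpace ℝ (Fin d)) (η τ : ℕ → ℝ) (ξ : ℕ → Ω → Ξ)
    (x : ℕ → Ω → EuclideanSpace ℝ (Fin d)) : Prop where
  init : ∀ ω, x 1 ω = x₁
  mem : ∀ t, 1 ≤ t → ∀ ω, x (t + 1) ω ∈ X
  argmin : ∀ t, 1 ≤ t → ∀ ω,
    IsMinOn
      (fun y => r y + inner ℝ (clip (τ t) (g (x t ω) (ξ t ω))) y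
        + ‖y - x t ω‖ ^ 2 / (2 * η t)
        + (η t / η (t + 1) - 1) * ‖y - x₁‖ ^ 2 / (2 * η t))
      X (x (t + 1) ω)

/-- The average iterate `(x 2 + ⋯ + x (T + 1)) / T`. -/
def avgIterate {d : ℕ} {Ω : Type*} (x : ℕ → Ω → EuclideanSpace ℝ (Fin d)) (T : ℕ) (ω : Ω) :
    EuclideanSpace ℝ (Fin d) :=
  (1 / (T : ℝ)) • ∑ t ∈ Finset.Icc 1 T, x (t + 1) ω

/-- The generalized effective dimension `σl² / σs²`, with the convention `0 / 0 = 0`. -/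
def dEff (σs σl : ℝ) : ℝ := σl ^ 2 / σs ^ 2

/-- `φ⋆ = max {√d_eff ln(3/δ), d_eff 1[p < 2]}`. -/
def phiStar (p σs σl δ : ℝ) : ℝ :=
  max (√(dEff σs σl) * Real.log (3 / δ)) (dEff σs σl * (if p < 2 then 1 else 0))

/-- `ψ⋆ = 1 + ln φ⋆`. In the noiseless case `φ⋆ = 0`, and there this is only used through the
product `φ⋆ ψ⋆`, which is `0`. -/
def psiStar (p σs σl δ : ℝ) : ℝ := 1 + Real.log (phiStar p σs σl δ)

/-- `τ⋆ = (min {σs σl^(p-1) / ln(3/δ), σs² / (σl^(2-p) 1[p < 2])})^(1/p)`: the second entry of the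
minimum is `+∞` if `p = 2`; in the noiseless case `τ⋆ = 0`. -/
def tauStar (p σs σl δ : ℝ) : ℝ :=
  (if p < 2 then min (σs * σl ^ (p - 1) / Real.log (3 / δ)) (σs ^ 2 / σl ^ (2 - p))
    else σs * σl ^ (p - 1) / Real.log (3 / δ)) ^ (1 / p)

/-- `γ⋆ = (D / G) / (φ⋆ ψ⋆ + ln(3/δ))`. -/
def gammaStar (p σs σl G D δ : ℝ) : ℝ :=
  (D / G) / (phiStar p σs σl δ * psiStar p σs σl δ + Real.log (3 / δ))

/-- `η⋆ = (D / G) / √(σl^p / G^p + 1)`. -/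
def etaStar (p σl G D : ℝ) : ℝ := (D / G) / √(σl ^ p / G ^ p + 1)

/-- `λ⋆ = D / √(ln²(3/δ) + σl^p / τ⋆^p + σs² σl^(2p-2) / τ⋆^(2p))`, with the convention
`0 / 0 = 0` in the noiseless case. -/
def lambdaStar (p σs σl D δ : ℝ) : ℝ :=
  D / √(Real.log (3 / δ) ^ 2 + σl ^ p / tauStar p σs σl δ ^ p
    + σs ^ 2 * σl ^ (2 * p - 2) / tauStar p σs σl δ ^ (2 * p))

/-- The stepsize `η_t = min {γ⋆, η⋆ / √t, λ⋆ / (τ⋆ t^(1/p))}`, whose last entry is `+∞` in the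
noiseless case `τ⋆ = 0`. -/
def stepSize (p σs σl G D δ : ℝ) (t : ℕ) : ℝ :=
  if tauStar p σs σl δ = 0 then
    min (gammaStar p σs σl G D δ) (etaStar p σl G D / √t)
  else
    min (min (gammaStar p σs σl G D δ) (etaStar p σl G D / √t))
      (lambdaStar p σs σl D δ / (tauStar p σs σl δ * (t : ℝ) ^ (1 / p)))

/-- The clipping threshold `τ_t = max {2 G, τ⋆ t^(1/p)}`. -/
def clipThreshold (p σs σl G δ : ℝ) (t : ℕ) : ℝ :=
  max (2 * G) (tauStar p σs σl δ * (t : ℝ) ^ (1 / p))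

/-- The anytime convergence rate. -/
def rate (p σs σl G D δ : ℝ) (T : ℕ) : ℝ :=
  (phiStar p σs σl δ * psiStar p σs σl δ + Real.log (3 / δ)) * G * D / T
    + (σl ^ (p / 2) * G ^ (1 - p / 2) + G) * D / √T
    + (σs ^ (2 / p - 1) * σl ^ (2 - 2 / p)
        + σs ^ (1 / p) * σl ^ (1 - 1 / p) * Real.log (3 / δ) ^ (1 - 1 / p)) * D
      / (T : ℝ) ^ (1 - 1 / p)

end StabilizedClippedSGD

end

open StabilizedClippedSGD

namespace StabilizedClippedSGD

/-! ### Pointwise bounds for the error of a clipped gradient. -/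

section Pointwise

variable {d : ℕ}

/-! Put R = D²/η_{T+1}. The core claim is that, with probability at least 1 - δ/3, the regret up to
time T is at most a constant times R. Jensen's inequality (`avgIterate_gap_le`) and the comparison
of R/T with the rate (`rate_of_noise`, `rate_of_noiseless`) then finish the proof.

The anchor term ‖x - x₁‖² of the update makes the weighted distances telescope against D²/(2η_{t+1})
alone (`stabilized_regret_le`), so no diameter of X enters. With e_t the error of the clipped
gradient, there remain the terms ⟨x⋆ - x_t, e_t⟩ + η_t‖e_t‖² + 4η_t G². The vector x⋆ - x_t has no a
priori bound, so it is replaced by a weight that vanishes once some ‖x⋆ - x_u‖ exceeds k√(η_u R).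
This weight is predictable; hence the exponential moment of the stopped sum, linear and quadratic
parts together, is controlled one sample at a time (`ClipErrorBound.lintegral_exp_le`,
`lintegral_exp_sum_le`), and Markov's inequality bounds that sum by a multiple of R that is affine
in k (`stopped_error_le`). The regret inequality also bounds ‖x⋆ - x_{t+1}‖²/(2η_{t+1}), and the
radius corresponds to k²R/2, which for large k beats an affine function of k. So the stopping never
happens (`regret_le_of_isAdmissible`).

The input is a bound on the bias, the directional variance and the total variance of the clipped
gradient (`IsHeavyTailedOracle.clipErrorBound`); the first two keep σs apart from σl. That the
weighted sums of these bounds are O(R) is `isAdmissible_of_noise`. There λ⋆ pays for the terms tied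
to the growing threshold τ⋆t^(1/p), η⋆ for the terms proportional to Ση_t, and γ⋆ together with η⋆
for φ⋆Ση_t/t. Splitting that last sum near t = φ⋆² is what creates ψ⋆ (`sum_stepsize_div_le`). -/

lemma clip_of_norm_le {τ : ℝ} {g : EuclideanSpace ℝ (Fin d)} (h : ‖g‖ ≤ τ) : clip τ g = g := by
  rcases eq_or_ne g 0 with rfl | hg
  · simp [clip]
  · have : 1 ≤ τ / ‖g‖ := (one_le_div (norm_pos_iff.2 hg)).2 h
    simp [clip, min_eq_left this]

lemma clip_of_lt_norm {τ : ℝ} {g : EuclideanSpace ℝ (Fin d)} (hτ : 0 ≤ τ) (h : τ < ‖g‖) :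
    clip τ g = (τ / ‖g‖) • g := by
  have : τ / ‖g‖ ≤ 1 := (div_le_one (hτ.trans_lt h)).2 h.le
  simp [clip, min_eq_right this]

lemma norm_clip_le {τ : ℝ} (hτ : 0 ≤ τ) (g : EuclideanSpace ℝ (Fin d)) : ‖clip τ g‖ ≤ τ := by
  rcases le_or_gt ‖g‖ τ with h | h
  · rwa [clip_of_norm_le h]
  · have hg : 0 < ‖g‖ := hτ.trans_lt h
    rw [clip_of_lt_norm hτ h, norm_smul, Real.norm_of_nonneg (by positivity),
      div_mul_cancel₀ _ hg.ne']

lemma measurable_clip (τ : ℝ) : Measurable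
    (clip τ : EuclideanSpace ℝ (Fin d) → EuclideanSpace ℝ (Fin d)) := by
  unfold clip
  fun_prop

lemma sq_le_rpow_mul_rpow {u m p : ℝ} (hu : 0 ≤ u) (hum : u ≤ m) (hp : 0 < p) (hp2 : p ≤ 2) :
    u ^ 2 ≤ m ^ (2 - p) * u ^ p := by
  rcases hu.eq_or_lt with rfl | hu
  · simp [Real.zero_rpow hp.ne']
  · calc u ^ 2 = u ^ (2 - p) * u ^ p := by
          rw [← Real.rpow_add hu, sub_add_cancel]; norm_cast
      _ ≤ m ^ (2 - p) * u ^ p := by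
          gcongr

variable {τ G p : ℝ} {v n : EuclideanSpace ℝ (Fin d)}

/-- The error of a clipped stochastic gradient, outside of the trivial case in which
the gradient is not clipped. -/
lemma clip_error_of_lt_norm (hG : 0 < G) (hτ : 2 * G ≤ τ) (hv : ‖v‖ ≤ G) (h : τ < ‖v + n‖) :
    ∃ c : ℝ, 0 ≤ c ∧ c ≤ 1 ∧ clip τ (v + n) - v = c • n - (1 - c) • v ∧
      ‖c • n‖ ≤ 3 / 2 * τ ∧ 1 ≤ 2 / τ * ‖n‖ := by
  have hτ0 : 0 < τ := by linarith
  have hpos : 0 < ‖v + n‖ := hτ0.trans h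
  have hc0 : 0 ≤ τ / ‖v + n‖ := by positivity
  have hc1 : τ / ‖v + n‖ ≤ 1 := (div_le_one hpos).2 h.le
  refine ⟨τ / ‖v + n‖, hc0, hc1, ?_, ?_, ?_⟩
  · rw [clip_of_lt_norm hτ0.le h]
    module
  · have h1 : (τ / ‖v + n‖) • n = (τ / ‖v + n‖) • (v + n) - (τ / ‖v + n‖) • v := by module
    have h2 : ‖(τ / ‖v + n‖) • (v + n)‖ = τ := by
      rw [norm_smul, Real.norm_of_nonneg hc0, div_mul_cancel₀ _ hpos.ne']
    have h3 : ‖(τ / ‖v + n‖) • v‖ ≤ G := by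
      rw [norm_smul, Real.norm_of_nonneg hc0]
      nlinarith [norm_nonneg v]
    calc ‖(τ / ‖v + n‖) • n‖ ≤ τ + G := by
          rw [h1]
          exact (norm_sub_le _ _).trans (by linarith)
      _ ≤ 3 / 2 * τ := by linarith
  · rw [div_mul_eq_mul_div, one_le_div hτ0]
    linarith [norm_add_le v n]

lemma norm_clip_error_le (hG : 0 < G) (hτ : 2 * G ≤ τ) (hv : ‖v‖ ≤ G)
    (g : EuclideanSpace ℝ (Fin d)) :
    ‖clip τ g - v‖ ≤ 3 / 2 * τ :=
  (norm_sub_le _ _).trans (by linarith [norm_clip_le (by linarith : 0 ≤ τ) g])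

/-- A general seminorm treats the norm and the directions |⟨e, ·⟩| at once. Boundedness by 3τ/2
trades a square for a p-th power. Clipping also shrinks v by at most G, but only where 2‖n‖/τ ≥ 1,
so that G² can be multiplied by (2‖n‖/τ)^p. -/
lemma seminorm_clip_error_sq_le (N : Seminorm ℝ (EuclideanSpace ℝ (Fin d))) (hN : ∀ u, N u ≤ ‖u‖)
    (hG : 0 < G) (hτ : 2 * G ≤ τ) (hv : ‖v‖ ≤ G) (hp : 0 < p) (hp2 : p ≤ 2) :
    N (clip τ (v + n) - v) ^ 2 ≤
      2 * (3 / 2 * τ) ^ (2 - p) * N n ^ p + 2 * G ^ 2 * (2 / τ) ^ p * ‖n‖ ^ p := by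
  have hτ0 : 0 < τ := by linarith
  have hNn := apply_nonneg N n
  rcases le_or_gt ‖v + n‖ τ with h | h
  · have hd : clip τ (v + n) - v = n := by rw [clip_of_norm_le h]; abel
    have hn : ‖n‖ ≤ 3 / 2 * τ := by
      calc ‖n‖ = ‖(v + n) - v‖ := by congr 1; abel
        _ ≤ 3 / 2 * τ := (norm_sub_le _ _).trans (by linarith)
    have h1 := sq_le_rpow_mul_rpow hNn ((hN n).trans hn) hp hp2
    have h2 : 0 ≤ 2 * G ^ 2 * (2 / τ) ^ p * ‖n‖ ^ p := by positivity
    have h3 : 0 ≤ (3 / 2 * τ) ^ (2 - p) * N n ^ p := by positivity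
    rw [hd]
    linarith
  · obtain ⟨c, hc0, hc1, hd, hcn, hn⟩ := clip_error_of_lt_norm hG hτ hv h
    have h1 : N (c • n) ^ 2 ≤ (3 / 2 * τ) ^ (2 - p) * N n ^ p := by
      have hs : N (c • n) = c * N n := by rw [map_smul_eq_mul, Real.norm_of_nonneg hc0]
      refine (sq_le_rpow_mul_rpow (apply_nonneg N _) ((hN _).trans hcn) hp hp2).trans ?_
      gcongr
      rw [hs]
      exact mul_le_of_le_one_left hNn hc1
    have h2 : N ((1 - c) • v) ≤ G := by
      rw [map_smul_eq_mul, Real.norm_of_nonneg (by linarith)]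
      nlinarith [hN v, apply_nonneg N v]
    have h3 : N ((1 - c) • v) ^ 2 ≤ G ^ 2 := by gcongr
    have h4 : 1 ≤ (2 / τ) ^ p * ‖n‖ ^ p := by
      rw [← Real.mul_rpow (by positivity) (norm_nonneg _)]
      exact Real.one_le_rpow hn hp.le
    have h5 : G ^ 2 ≤ G ^ 2 * ((2 / τ) ^ p * ‖n‖ ^ p) := le_mul_of_one_le_right (by positivity) h4
    have h6 : N (c • n - (1 - c) • v) ≤ N (c • n) + N ((1 - c) • v) := map_sub_le_add N _ _
    have h7 : N (c • n - (1 - c) • v) ^ 2 ≤ (N (c • n) + N ((1 - c) • v)) ^ 2 := by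
      gcongr
    rw [hd]
    nlinarith [sq_nonneg (N (c • n) - N ((1 - c) • v))]

/-- The difference vanishes unless clipping is active, and then 2‖n‖/τ ≥ 1. Multiplying |⟨e, n⟩| by
the power p - 1 of this ratio and G by its power p gives the bound. Keeping the factor |⟨e, n⟩| is
what later yields σs σl^(p-1) instead of σl^p. -/
lemma abs_inner_clip_sub_le (hG : 0 < G) (hτ : 2 * G ≤ τ) (hv : ‖v‖ ≤ G) (hp : 1 < p)
    {e : EuclideanSpace ℝ (Fin d)} (he : ‖e‖ = 1) :
    |inner ℝ e (clip τ (v + n) - (v + n))| ≤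
      (2 / τ) ^ (p - 1) * (|inner ℝ e n| * ‖n‖ ^ (p - 1)) + G * (2 / τ) ^ p * ‖n‖ ^ p := by
  have hτ0 : 0 < τ := by linarith
  rcases le_or_gt ‖v + n‖ τ with h | h
  · rw [clip_of_norm_le h]
    simp only [sub_self, inner_zero_right, abs_zero]
    positivity
  · obtain ⟨c, hc0, hc1, hd, -, hn⟩ := clip_error_of_lt_norm hG hτ hv h
    have hd' : clip τ (v + n) - (v + n) = (-(1 - c)) • n + (-(1 - c)) • v := by
      rw [← sub_sub, hd]
      module
    have h1 : 1 ≤ (2 / τ) ^ (p - 1) * ‖n‖ ^ (p - 1) := by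
      rw [← Real.mul_rpow (by positivity) (norm_nonneg _)]
      exact Real.one_le_rpow hn (by linarith)
    have h2 : 1 ≤ (2 / τ) ^ p * ‖n‖ ^ p := by
      rw [← Real.mul_rpow (by positivity) (norm_nonneg _)]
      exact Real.one_le_rpow hn (by linarith)
    have h3 : |inner ℝ e v| ≤ G := by
      refine (abs_real_inner_le_norm e v).trans ?_
      rw [he, one_mul]
      exact hv
    have h4 : |inner ℝ e (clip τ (v + n) - (v + n))| ≤ |inner ℝ e n| + G := by
      rw [hd', inner_add_right, inner_smul_right, inner_smul_right, ← mul_add, abs_mul, abs_neg,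
        abs_of_nonneg (by linarith : (0 : ℝ) ≤ 1 - c)]
      calc (1 - c) * |inner ℝ e n + inner ℝ e v| ≤ 1 * |inner ℝ e n + inner ℝ e v| := by
            gcongr
            linarith
        _ ≤ |inner ℝ e n| + G := by
            rw [one_mul]
            exact (abs_add_le _ _).trans (by linarith)
    have h5 := mul_le_mul_of_nonneg_left h1 (abs_nonneg (inner ℝ e n))
    have h6 := mul_le_mul_of_nonneg_left h2 hG.le
    linarith

end Pointwise

/-! ### Bias and variance of the clipped gradient. -/

section Moments

variable {d : ℕ} {Ξ : Type*} [MeasurableSpace Ξ] {P : Measure Ξ}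

lemma integrable_and_integral_le_of_lintegral_le {h : Ξ → ℝ} {c : ℝ}
    (hm : AEStronglyMeasurable h P) (h0 : ∀ z, 0 ≤ h z) (hc : 0 ≤ c)
    (hle : ∫⁻ z, ENNReal.ofReal (h z) ∂P ≤ ENNReal.ofReal c) :
    Integrable h P ∧ ∫ z, h z ∂P ≤ c := by
  constructor
  · exact (lintegral_ofReal_ne_top_iff_integrable hm (.of_forall h0)).1
      (hle.trans_lt ENNReal.ofReal_lt_top).ne
  · rw [integral_eq_lintegral_of_nonneg_ae (.of_forall h0) hm]
    exact ENNReal.toReal_le_of_le_ofReal hc hle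

/-- Bounds for the first two moments of the error of a clipped stochastic gradient, uniform in
the query point. -/
structure ClipErrorBound (X : Set (EuclideanSpace ℝ (Fin d)))
    (f' : EuclideanSpace ℝ (Fin d) → EuclideanSpace ℝ (Fin d))
    (g : EuclideanSpace ℝ (Fin d) → Ξ → EuclideanSpace ℝ (Fin d)) (P : Measure Ξ)
    (τ B V W : ℝ) : Prop where
  mean : ∀ y ∈ X, ∀ w, ∫ z, inner ℝ w (clip τ (g y z) - f' y) ∂P ≤ ‖w‖ * B
  variance_inner : ∀ y ∈ X, ∀ w, ∫ z, inner ℝ w (clip τ (g y z) - f' y) ^ 2 ∂P ≤ ‖w‖ ^ 2 * V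
  variance_norm : ∀ y ∈ X, ∫ z, ‖clip τ (g y z) - f' y‖ ^ 2 ∂P ≤ W

variable {X : Set (EuclideanSpace ℝ (Fin d))}
  {f' : EuclideanSpace ℝ (Fin d) → EuclideanSpace ℝ (Fin d)}
  {g : EuclideanSpace ℝ (Fin d) → Ξ → EuclideanSpace ℝ (Fin d)} {p σs σl τ G : ℝ}

lemma IsHeavyTailedOracle.integrable_norm_rpow (h : IsHeavyTailedOracle X f' g P p σs σl)
    {y : EuclideanSpace ℝ (Fin d)} (hy : y ∈ X) :
    Integrable (fun z => ‖g y z - f' y‖ ^ p) P ∧ ∫ z, ‖g y z - f' y‖ ^ p ∂P ≤ σl ^ p :=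
  integrable_and_integral_le_of_lintegral_le
    (((((h.integrable y hy).1.sub aestronglyMeasurable_const).norm.aemeasurable).pow_const
      p).aestronglyMeasurable)
    (fun z => by positivity) (Real.rpow_nonneg (h.σs_nonneg.trans h.σs_le_σl) _)
    (h.moment_norm y hy)

lemma IsHeavyTailedOracle.integrable_inner_rpow (h : IsHeavyTailedOracle X f' g P p σs σl)
    {y : EuclideanSpace ℝ (Fin d)} (hy : y ∈ X) {e : EuclideanSpace ℝ (Fin d)} (he : ‖e‖ = 1) :
    Integrable (fun z => |inner ℝ e (g y z - f' y)| ^ p) P ∧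
      ∫ z, |inner ℝ e (g y z - f' y)| ^ p ∂P ≤ σs ^ p := by
  have hm : AEMeasurable (fun z => inner ℝ e (g y z - f' y)) P :=
    aemeasurable_const.inner ((h.integrable y hy).1.aemeasurable.sub aemeasurable_const)
  have hm' : AEStronglyMeasurable (fun z => |inner ℝ e (g y z - f' y)| ^ p) P :=
    (hm.norm.pow_const p).aestronglyMeasurable
  exact integrable_and_integral_le_of_lintegral_le hm' (fun z => by positivity)
    (Real.rpow_nonneg h.σs_nonneg _) (h.moment_inner y hy e he)

/-- Without noise, the clipping error vanishes. -/
lemma IsHeavyTailedOracle.clipErrorBound_zero (h : IsHeavyTailedOracle X f' g P p 0 0)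
    (hf' : ∀ y ∈ X, ‖f' y‖ ≤ τ) : ClipErrorBound X f' g P τ 0 0 0 := by
  have hd : ∀ y ∈ X, ∀ᵐ z ∂P, clip τ (g y z) - f' y = 0 := by
    intro y hy
    have hp : p ≠ 0 := by linarith [h.one_lt_p]
    obtain ⟨hi, hle⟩ := h.integrable_norm_rpow hy
    rw [Real.zero_rpow hp] at hle
    have h0 : ∫ z, ‖g y z - f' y‖ ^ p ∂P = 0 :=
      le_antisymm hle (integral_nonneg fun z => by positivity)
    rw [integral_eq_zero_iff_of_nonneg (fun z => by positivity) hi] at h0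
    filter_upwards [h0] with z hz
    have : ‖g y z - f' y‖ = 0 := by
      simpa [Real.rpow_eq_zero (norm_nonneg _) hp] using hz
    have hgz : g y z = f' y := sub_eq_zero.1 (norm_eq_zero.1 this)
    rw [hgz, clip_of_norm_le (hf' y hy), sub_self]
  refine ⟨fun y hy w => ?_, fun y hy w => ?_, fun y hy => ?_⟩ <;>
    refine le_of_eq ?_ <;> rw [integral_congr_ae (g := fun _ => (0 : ℝ))] <;> try simp
  all_goals
    filter_upwards [hd y hy] with z hz
    simp [hz]

variable [IsProbabilityMeasure P]

lemma IsHeavyTailedOracle.integral_inner_eq_zero (h : IsHeavyTailedOracle X f' g P p σs σl)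
    {y : EuclideanSpace ℝ (Fin d)} (hy : y ∈ X) (e : EuclideanSpace ℝ (Fin d)) :
    ∫ z, inner ℝ e (g y z - f' y) ∂P = 0 := by
  have hi := h.integrable y hy
  rw [integral_inner (f := fun z => g y z - f' y) (hi.sub (integrable_const _)),
    integral_sub hi (integrable_const _), h.unbiased y hy]
  simp

lemma IsHeavyTailedOracle.integrable_clip_error (h : IsHeavyTailedOracle X f' g P p σs σl)
    (hτ : 0 ≤ τ) {y : EuclideanSpace ℝ (Fin d)} (hy : y ∈ X) :
    Integrable (fun z => clip τ (g y z) - f' y) P := by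
  refine Integrable.sub (Integrable.of_bound ?_ τ (.of_forall fun z => norm_clip_le hτ _))
    (integrable_const _)
  exact ((measurable_clip τ).comp_aemeasurable
    (h.integrable y hy).1.aemeasurable).aestronglyMeasurable

/-- Young's inequality for u/s and (v/l)^(p-1) with weights 1/p and 1 - 1/p. Integrated with s = σs
and l = σl it does the work of Hölder's inequality for the mixed moment. -/
lemma mul_rpow_sub_one_le {u v s l p : ℝ} (hu : 0 ≤ u) (hv : 0 ≤ v) (hs : 0 < s) (hl : 0 < l)
    (hp : 1 < p) :
    u * v ^ (p - 1) ≤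
      s * l ^ (p - 1) * (1 / p * (u ^ p / s ^ p) + (1 - 1 / p) * (v ^ p / l ^ p)) := by
  have hp0 : 0 < p := by linarith
  have hp1 : 1 / p ≤ 1 := (div_le_one hp0).2 hp.le
  have h := Real.geom_mean_le_arith_mean2_weighted (w₁ := 1 / p) (w₂ := 1 - 1 / p)
    (p₁ := (u / s) ^ p) (p₂ := (v / l) ^ p) (by positivity) (by linarith) (by positivity)
    (by positivity) (by ring)
  rw [← Real.rpow_mul (by positivity), ← Real.rpow_mul (by positivity), mul_one_div_cancel hp0.ne',
    Real.rpow_one, show p * (1 - 1 / p) = p - 1 by field_simp, Real.div_rpow hv hl.le,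
    Real.div_rpow hu hs.le, Real.div_rpow hv hl.le] at h
  calc u * v ^ (p - 1) = s * l ^ (p - 1) * (u / s * (v ^ (p - 1) / l ^ (p - 1))) := by
        field_simp
    _ ≤ _ := by gcongr

/-- Unbiasedness allows the unclipped error to be subtracted for free, so only the part removed by
clipping contributes to the mean. -/
lemma IsHeavyTailedOracle.integral_inner_clip_error_le
    (h : IsHeavyTailedOracle X f' g P p σs σl)
    (hσ : 0 < σs) (hG : 0 < G) (hf' : ∀ y ∈ X, ‖f' y‖ ≤ G) (hτ : 2 * G ≤ τ)
    {y : EuclideanSpace ℝ (Fin d)} (hy : y ∈ X) {e : EuclideanSpace ℝ (Fin d)} (he : ‖e‖ = 1) :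
    ∫ z, inner ℝ e (clip τ (g y z) - f' y) ∂P ≤
      2 * σs * σl ^ (p - 1) / τ ^ (p - 1) + 4 * G * (σl ^ p / τ ^ p) := by
  have hp := h.one_lt_p
  have hp2 := h.p_le_two
  have hp0 : 0 < p := by linarith
  have hτ0 : 0 < τ := by linarith
  have hl : 0 < σl := hσ.trans_le h.σs_le_σl
  have hp1 : 1 / p ≤ 1 := (div_le_one hp0).2 hp.le
  obtain ⟨hi, hiB⟩ := h.integrable_inner_rpow hy he
  obtain ⟨hn, hnB⟩ := h.integrable_norm_rpow hy
  have hd := h.integrable_clip_error hτ0.le hy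
  have hnoise : Integrable (fun z => g y z - f' y) P :=
    (h.integrable y hy).sub (integrable_const _)
  have hQ : Integrable (fun z => (2 / τ) ^ (p - 1) * (σs * σl ^ (p - 1) *
      (1 / p * (|inner ℝ e (g y z - f' y)| ^ p / σs ^ p)
        + (1 - 1 / p) * (‖g y z - f' y‖ ^ p / σl ^ p)))
      + G * (2 / τ) ^ p * ‖g y z - f' y‖ ^ p) P :=
    (((((hi.div_const _).const_mul _).add ((hn.div_const _).const_mul _)).const_mul _).const_mul
      _).add (hn.const_mul _)
  calc ∫ z, inner ℝ e (clip τ (g y z) - f' y) ∂P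
      = ∫ z, (inner ℝ e (clip τ (g y z) - f' y) - inner ℝ e (g y z - f' y)) ∂P := by
        rw [integral_sub (hd.const_inner e) (hnoise.const_inner e),
          h.integral_inner_eq_zero hy, sub_zero]
    _ ≤ _ := by
        refine integral_mono ((hd.const_inner e).sub (hnoise.const_inner e)) hQ fun z => ?_
        have h1 := abs_inner_clip_sub_le (n := g y z - f' y) hG hτ (hf' y hy) hp he
        rw [add_sub_cancel] at h1
        have h2 := mul_rpow_sub_one_le (abs_nonneg (inner ℝ e (g y z - f' y)))
          (norm_nonneg (g y z - f' y)) hσ hl hp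
        calc inner ℝ e (clip τ (g y z) - f' y) - inner ℝ e (g y z - f' y)
            = inner ℝ e (clip τ (g y z) - g y z) := by rw [← inner_sub_right]; congr 1; abel
          _ ≤ _ := (le_abs_self _).trans (h1.trans (by gcongr))
    _ = (2 / τ) ^ (p - 1) * (σs * σl ^ (p - 1) *
          (1 / p * ((∫ z, |inner ℝ e (g y z - f' y)| ^ p ∂P) / σs ^ p)
          + (1 - 1 / p) * ((∫ z, ‖g y z - f' y‖ ^ p ∂P) / σl ^ p)))
        + G * (2 / τ) ^ p * ∫ z, ‖g y z - f' y‖ ^ p ∂P := by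
        have hlin : ∀ a b : ℝ,
            ∫ z, (a * |inner ℝ e (g y z - f' y)| ^ p + b * ‖g y z - f' y‖ ^ p) ∂P =
              a * (∫ z, |inner ℝ e (g y z - f' y)| ^ p ∂P)
                + b * ∫ z, ‖g y z - f' y‖ ^ p ∂P := fun a b => by
          rw [integral_add (hi.const_mul _) (hn.const_mul _), integral_const_mul,
            integral_const_mul]
        have hab := hlin ((2 / τ) ^ (p - 1) * (σs * σl ^ (p - 1)) * (1 / p / σs ^ p))
          ((2 / τ) ^ (p - 1) * (σs * σl ^ (p - 1)) * ((1 - 1 / p) / σl ^ p) + G * (2 / τ) ^ p)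
        convert hab using 1
        · refine integral_congr_ae (.of_forall fun z => ?_)
          ring
        · ring
    _ ≤ (2 / τ) ^ (p - 1) * (σs * σl ^ (p - 1) *
          (1 / p * (σs ^ p / σs ^ p) + (1 - 1 / p) * (σl ^ p / σl ^ p)))
        + G * (2 / τ) ^ p * σl ^ p := by
        have : 0 ≤ 1 - 1 / p := by linarith
        gcongr
    _ = 2 ^ (p - 1) * (σs * σl ^ (p - 1) / τ ^ (p - 1)) + 2 ^ p * (G * (σl ^ p / τ ^ p)) := by
        rw [div_self (by positivity), div_self (by positivity),
          Real.div_rpow (by norm_num) hτ0.le, Real.div_rpow (by norm_num) hτ0.le]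
        ring
    _ ≤ 2 * (σs * σl ^ (p - 1) / τ ^ (p - 1)) + 4 * (G * (σl ^ p / τ ^ p)) := by
        have h1 : (2 : ℝ) ^ (p - 1) ≤ 2 := by
          simpa using Real.rpow_le_rpow_of_exponent_le (x := 2) (by norm_num)
            (by linarith : p - 1 ≤ 1)
        have h2 : (2 : ℝ) ^ p ≤ 4 := by
          have := Real.rpow_le_rpow_of_exponent_le (x := 2) (by norm_num) hp2
          norm_num at this ⊢
          exact this
        gcongr
    _ = _ := by ring

omit [IsProbabilityMeasure P] in
lemma IsHeavyTailedOracle.integral_seminorm_clip_error_sq_le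
    (h : IsHeavyTailedOracle X f' g P p σs σl)
    (hG : 0 < G) (hf' : ∀ y ∈ X, ‖f' y‖ ≤ G) (hτ : 2 * G ≤ τ)
    {y : EuclideanSpace ℝ (Fin d)} (hy : y ∈ X)
    (N : Seminorm ℝ (EuclideanSpace ℝ (Fin d))) (hN : ∀ u, N u ≤ ‖u‖) {s : ℝ}
    (hi : Integrable (fun z => N (g y z - f' y) ^ p) P ∧
      ∫ z, N (g y z - f' y) ^ p ∂P ≤ s ^ p) :
    ∫ z, N (clip τ (g y z) - f' y) ^ 2 ∂P ≤
      4 * τ ^ (2 - p) * s ^ p + 8 * G ^ 2 * (σl ^ p / τ ^ p) := by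
  have hp := h.one_lt_p
  have hp2 := h.p_le_two
  have hp0 : 0 < p := by linarith
  have hτ0 : 0 < τ := by linarith
  obtain ⟨hn, hnB⟩ := h.integrable_norm_rpow hy
  have hs : 0 ≤ s ^ p := (integral_nonneg fun z => by positivity).trans hi.2
  calc ∫ z, N (clip τ (g y z) - f' y) ^ 2 ∂P
      ≤ ∫ z, (2 * (3 / 2 * τ) ^ (2 - p) * N (g y z - f' y) ^ p
        + 2 * G ^ 2 * (2 / τ) ^ p * ‖g y z - f' y‖ ^ p) ∂P := by
        refine integral_mono_of_nonneg (.of_forall fun z => by positivity)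
          ((hi.1.const_mul _).add (hn.const_mul _)) (.of_forall fun z => ?_)
        have := seminorm_clip_error_sq_le (n := g y z - f' y) N hN hG hτ (hf' y hy) hp0 hp2
        rwa [add_sub_cancel] at this
    _ = 2 * (3 / 2 * τ) ^ (2 - p) * ∫ z, N (g y z - f' y) ^ p ∂P
        + 2 * G ^ 2 * (2 / τ) ^ p * ∫ z, ‖g y z - f' y‖ ^ p ∂P := by
        rw [integral_add (hi.1.const_mul _) (hn.const_mul _), integral_const_mul,
          integral_const_mul]
    _ ≤ 2 * (3 / 2 * τ) ^ (2 - p) * s ^ p + 2 * G ^ 2 * (2 / τ) ^ p * σl ^ p := by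
        gcongr
        exact hi.2
    _ = (3 / 2) ^ (2 - p) * (2 * (τ ^ (2 - p) * s ^ p))
        + 2 ^ p * (2 * (G ^ 2 * (σl ^ p / τ ^ p))) := by
        rw [Real.mul_rpow (by norm_num) hτ0.le, Real.div_rpow (by norm_num) hτ0.le]
        ring
    _ ≤ 2 * (2 * (τ ^ (2 - p) * s ^ p)) + 4 * (2 * (G ^ 2 * (σl ^ p / τ ^ p))) := by
        have hl : 0 ≤ σl ^ p := (integral_nonneg fun z => by positivity).trans hnB
        have h1 : (3 / 2 : ℝ) ^ (2 - p) ≤ 2 := by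
          have := Real.rpow_le_rpow_of_exponent_le (x := 3 / 2) (by norm_num)
            (by linarith : 2 - p ≤ 1)
          rw [Real.rpow_one] at this
          linarith
        have h2 : (2 : ℝ) ^ p ≤ 4 := by
          have := Real.rpow_le_rpow_of_exponent_le (x := 2) (by norm_num) hp2
          norm_num at this ⊢
          exact this
        gcongr
    _ = _ := by ring

/-- The moment bounds for the clipping error in the presence of noise. -/
lemma IsHeavyTailedOracle.clipErrorBound (h : IsHeavyTailedOracle X f' g P p σs σl)
    (hσ : 0 < σs) (hG : 0 < G) (hf' : ∀ y ∈ X, ‖f' y‖ ≤ G) (hτ : 2 * G ≤ τ) :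
    ClipErrorBound X f' g P τ
      (2 * σs * σl ^ (p - 1) / τ ^ (p - 1) + 4 * G * (σl ^ p / τ ^ p))
      (4 * τ ^ (2 - p) * σs ^ p + 8 * G ^ 2 * (σl ^ p / τ ^ p))
      (4 * τ ^ (2 - p) * σl ^ p + 8 * G ^ 2 * (σl ^ p / τ ^ p)) := by
  have hscale : ∀ w : EuclideanSpace ℝ (Fin d), w ≠ 0 →
      ∃ e : EuclideanSpace ℝ (Fin d), ‖e‖ = 1 ∧ w = ‖w‖ • e := fun w hw =>
    ⟨‖w‖⁻¹ • w, by simp [norm_smul, hw],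
      (smul_inv_smul₀ (norm_ne_zero_iff.2 hw) w).symm⟩
  refine ⟨fun y hy w => ?_, fun y hy w => ?_, fun y hy => ?_⟩
  · rcases eq_or_ne w 0 with rfl | hw
    · simp
    obtain ⟨e, he, hwe⟩ := hscale w hw
    have h1 := h.integral_inner_clip_error_le hσ hG hf' hτ hy he
    calc ∫ z, inner ℝ w (clip τ (g y z) - f' y) ∂P
        = ‖w‖ * ∫ z, inner ℝ e (clip τ (g y z) - f' y) ∂P := by
          rw [← integral_const_mul]
          refine integral_congr_ae (.of_forall fun z => ?_)
          conv_lhs => rw [hwe]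
          exact real_inner_smul_left _ _ _
      _ ≤ _ := by gcongr
  · rcases eq_or_ne w 0 with rfl | hw
    · simp
    obtain ⟨e, he, hwe⟩ := hscale w hw
    -- The seminorm u ↦ |⟨e, u⟩|, whose p-th moment is the directional one.
    have h1 := h.integral_seminorm_clip_error_sq_le hG hf' hτ hy
      ((normSeminorm ℝ ℝ).comp (innerₛₗ ℝ e))
      (fun u => by simpa [he] using norm_inner_le_norm (𝕜 := ℝ) e u)
      (h.integrable_inner_rpow hy he)
    calc ∫ z, inner ℝ w (clip τ (g y z) - f' y) ^ 2 ∂P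
        = ‖w‖ ^ 2 *
            ∫ z, ((normSeminorm ℝ ℝ).comp (innerₛₗ ℝ e)) (clip τ (g y z) - f' y) ^ 2 ∂P := by
          rw [← integral_const_mul]
          refine integral_congr_ae (.of_forall fun z => ?_)
          conv_lhs => rw [hwe]
          simp [real_inner_smul_left, mul_pow]
      _ ≤ _ := by gcongr
  · exact h.integral_seminorm_clip_error_sq_le hG hf' hτ hy (normSeminorm ℝ _) (fun u => le_rfl)
      (h.integrable_norm_rpow hy)

end Moments

/-! ### Exponential moment of a single error term. -/

section ExponentialMoments

/-- From exp x ≤ 1 + x + x² for |x| ≤ 1 and (a + b)² ≤ 2a² + 2b², where 2b² ≤ b. The term b enters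
only linearly, so no fourth moment of the error will be needed. -/
lemma exp_add_le {a b : ℝ} (ha : |a| ≤ 1 / 2) (hb0 : 0 ≤ b) (hb : b ≤ 1 / 2) :
    Real.exp (a + b) ≤ 1 + a + 2 * a ^ 2 + 3 * b := by
  have h1 := abs_le.1 ha
  have h2 := Real.abs_exp_sub_one_sub_id_le (x := a + b) (abs_le.2 ⟨by linarith, by linarith⟩)
  have h3 := (abs_le.1 h2).2
  nlinarith [sq_nonneg (a - b)]

variable {d : ℕ} {Ξ : Type*} [MeasurableSpace Ξ] {P : Measure Ξ} [IsProbabilityMeasure P]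
  {X : Set (EuclideanSpace ℝ (Fin d))}
  {f' : EuclideanSpace ℝ (Fin d) → EuclideanSpace ℝ (Fin d)}
  {g : EuclideanSpace ℝ (Fin d) → Ξ → EuclideanSpace ℝ (Fin d)} {τ G B V W θ κ : ℝ}

/-- The linear and the quadratic error share one exponential, so a single application of Markov's
inequality will cover both. The two smallness hypotheses keep both parts of the exponent below 1/2,
by the bound 3τ/2 on the clipping error. -/
lemma ClipErrorBound.lintegral_exp_le (h : ClipErrorBound X f' g P τ B V W)
    {y : EuclideanSpace ℝ (Fin d)} (hy : y ∈ X) (hg : Integrable (g y) P) (hG : 0 < G)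
    (hf' : ‖f' y‖ ≤ G) (hτ : 2 * G ≤ τ) (hθ : 0 ≤ θ) (hκ : 0 ≤ κ) {w : EuclideanSpace ℝ (Fin d)}
    (hw : θ * (‖w‖ * (3 / 2 * τ)) ≤ 1 / 2) (hκτ : θ * (κ * (3 / 2 * τ) ^ 2) ≤ 1 / 2) :
    ∫⁻ z, ENNReal.ofReal (Real.exp
        (θ * (inner ℝ w (clip τ (g y z) - f' y) + κ * ‖clip τ (g y z) - f' y‖ ^ 2))) ∂P ≤
      ENNReal.ofReal (Real.exp
        (θ * (‖w‖ * B) + 2 * θ ^ 2 * (‖w‖ ^ 2 * V) + 3 * θ * (κ * W))) := by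
  have hτ0 : 0 < τ := by linarith
  set e : Ξ → EuclideanSpace ℝ (Fin d) := fun z => clip τ (g y z) - f' y with he
  have hem : AEMeasurable e P :=
    ((measurable_clip τ).comp_aemeasurable hg.1.aemeasurable).sub aemeasurable_const
  have heb : ∀ z, ‖e z‖ ≤ 3 / 2 * τ := fun z => norm_clip_error_le hG hτ hf' (g y z)
  have hin : ∀ z, |inner ℝ w (e z)| ≤ ‖w‖ * (3 / 2 * τ) := fun z =>
    (abs_real_inner_le_norm _ _).trans (by gcongr; exact heb z)
  have hsq : ∀ z, ‖e z‖ ^ 2 ≤ (3 / 2 * τ) ^ 2 := fun z => by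
    gcongr
    exact heb z
  have hinm : AEMeasurable (fun z => inner ℝ w (e z)) P := aemeasurable_const.inner hem
  have hi1 : Integrable (fun z => inner ℝ w (e z)) P :=
    .of_bound hinm.aestronglyMeasurable _ (.of_forall hin)
  have hi2 : Integrable (fun z => inner ℝ w (e z) ^ 2) P :=
    .of_bound (hinm.pow_const 2).aestronglyMeasurable ((‖w‖ * (3 / 2 * τ)) ^ 2)
      (.of_forall fun z => by
        rw [norm_pow]
        gcongr
        exact hin z)
  have hi3 : Integrable (fun z => ‖e z‖ ^ 2) P :=
    .of_bound (hem.norm.pow_const 2).aestronglyMeasurable ((3 / 2 * τ) ^ 2)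
      (.of_forall fun z => by
        rw [Real.norm_of_nonneg (by positivity)]
        exact hsq z)
  have hpt : ∀ z, Real.exp (θ * (inner ℝ w (e z) + κ * ‖e z‖ ^ 2)) ≤
      1 + θ * inner ℝ w (e z) + 2 * θ ^ 2 * inner ℝ w (e z) ^ 2 + 3 * θ * κ * ‖e z‖ ^ 2 := by
    intro z
    have h1 : |θ * inner ℝ w (e z)| ≤ 1 / 2 := by
      rw [abs_mul, abs_of_nonneg hθ]
      exact (mul_le_mul_of_nonneg_left (hin z) hθ).trans hw
    have h2 : θ * (κ * ‖e z‖ ^ 2) ≤ 1 / 2 := by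
      refine le_trans ?_ hκτ
      gcongr
      exact heb z
    have h3 := exp_add_le h1 (by positivity) h2
    calc _ = Real.exp (θ * inner ℝ w (e z) + θ * (κ * ‖e z‖ ^ 2)) := by ring_nf
      _ ≤ _ := h3
      _ = _ := by ring
  have hi12 : Integrable (fun z => 1 + θ * inner ℝ w (e z)) P :=
    (integrable_const 1).add (hi1.const_mul θ)
  have hi123 : Integrable (fun z => 1 + θ * inner ℝ w (e z)
      + 2 * θ ^ 2 * inner ℝ w (e z) ^ 2) P := hi12.add (hi2.const_mul _)
  have hint : Integrable (fun z => 1 + θ * inner ℝ w (e z) + 2 * θ ^ 2 * inner ℝ w (e z) ^ 2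
      + 3 * θ * κ * ‖e z‖ ^ 2) P :=
    hi123.add (hi3.const_mul _)
  calc ∫⁻ z, ENNReal.ofReal (Real.exp (θ * (inner ℝ w (e z) + κ * ‖e z‖ ^ 2))) ∂P
      ≤ ∫⁻ z, ENNReal.ofReal (1 + θ * inner ℝ w (e z) + 2 * θ ^ 2 * inner ℝ w (e z) ^ 2
        + 3 * θ * κ * ‖e z‖ ^ 2) ∂P :=
        lintegral_mono fun z => ENNReal.ofReal_le_ofReal (hpt z)
    _ = ENNReal.ofReal (∫ z, (1 + θ * inner ℝ w (e z) + 2 * θ ^ 2 * inner ℝ w (e z) ^ 2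
        + 3 * θ * κ * ‖e z‖ ^ 2) ∂P) :=
        (ofReal_integral_eq_lintegral_ofReal hint
          (.of_forall fun z => (Real.exp_pos _).le.trans (hpt z))).symm
    _ ≤ _ := by
        apply ENNReal.ofReal_le_ofReal
        rw [integral_add hi123 (hi3.const_mul _), integral_add hi12 (hi2.const_mul _),
          integral_add (integrable_const 1) (hi1.const_mul θ),
          integral_const_mul, integral_const_mul, integral_const_mul]
        simp only [integral_const, probReal_univ, smul_eq_mul, mul_one]
        have h1 := h.mean y hy w
        have h2 := h.variance_inner y hy w
        have h3 := h.variance_norm y hy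
        have h4 := Real.add_one_le_exp
          (θ * (‖w‖ * B) + 2 * θ ^ 2 * (‖w‖ ^ 2 * V) + 3 * θ * (κ * W))
        have h5 := mul_le_mul_of_nonneg_left h1 hθ
        have h6 := mul_le_mul_of_nonneg_left h2 (by positivity : 0 ≤ 2 * θ ^ 2)
        have h7 := mul_le_mul_of_nonneg_left h3 (by positivity : 0 ≤ 3 * θ * κ)
        linarith

end ExponentialMoments

/-! ### Exponential moments of sums with predictable coefficients. -/

section Independence

variable {Ω Ξ S : Type*} [MeasurableSpace Ω] [MeasurableSpace Ξ] [MeasurableSpace S]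
  {μ : Measure Ω} [IsProbabilityMeasure μ] {P : Measure Ξ} [IsProbabilityMeasure P]

/-- This replaces conditioning on the past: the joint law of U and ζ is a product, and Tonelli
integrates out ζ with U frozen. -/
lemma lintegral_mul_le_of_indepFun {T : Type*} [MeasurableSpace T] {U : Ω → T} {ζ : Ω → Ξ}
    (hU : Measurable U)
    (hζ : Measurable ζ) (hind : IndepFun U ζ μ) (hmap : μ.map ζ = P) {A : T → ENNReal}
    (hA : Measurable A) {Ψ : T × Ξ → ENNReal} (hΨ : Measurable Ψ) {c : ENNReal}
    (hc : ∀ ω, ∫⁻ z, Ψ (U ω, z) ∂P ≤ c) :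
    ∫⁻ ω, A (U ω) * Ψ (U ω, ζ ω) ∂μ ≤ (∫⁻ ω, A (U ω) ∂μ) * c := by
  have hm : Measurable fun q : T × Ξ => A q.1 * Ψ q := (hA.comp measurable_fst).mul hΨ
  calc ∫⁻ ω, A (U ω) * Ψ (U ω, ζ ω) ∂μ
      = ∫⁻ q, A q.1 * Ψ q ∂(μ.map fun ω => (U ω, ζ ω)) :=
        (lintegral_map hm (hU.prodMk hζ)).symm
    _ = ∫⁻ s, ∫⁻ z, A s * Ψ (s, z) ∂P ∂(μ.map U) := by
        rw [(indepFun_iff_map_prod_eq_prod_map_map hU.aemeasurable hζ.aemeasurable).1 hind, hmap,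
          lintegral_prod _ hm.aemeasurable]
    _ = ∫⁻ ω, ∫⁻ z, A (U ω) * Ψ (U ω, z) ∂P ∂μ := lintegral_map hm.lintegral_prod_right' hU
    _ ≤ ∫⁻ ω, A (U ω) * c ∂μ := by
        refine lintegral_mono fun ω => ?_
        rw [lintegral_const_mul (f := fun z => Ψ (U ω, z)) _ (hΨ.comp measurable_prodMk_left)]
        gcongr
        exact hc ω
    _ = _ := lintegral_mul_const _ (hA.comp hU)

/-- The σ-algebra generated by the first `n` samples. -/
abbrev pastσ (ζ : ℕ → Ω → Ξ) (n : ℕ) : MeasurableSpace Ω :=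
  ⨆ i ∈ Set.Iio n, MeasurableSpace.comap (ζ i) inferInstance

variable {ζ : ℕ → Ω → Ξ}

omit [MeasurableSpace Ω] in
lemma pastσ_mono (ζ : ℕ → Ω → Ξ) : Monotone (pastσ ζ) := fun _ _ h =>
  biSup_mono fun _ hi => lt_of_lt_of_le hi h

lemma pastσ_le (hζ : ∀ i, Measurable (ζ i)) (n : ℕ) : pastσ ζ n ≤ ‹MeasurableSpace Ω› :=
  iSup₂_le fun i _ => (hζ i).comap_le

omit [MeasurableSpace Ω] in
lemma measurable_pastσ_succ (ζ : ℕ → Ω → Ξ) (n : ℕ) : Measurable[pastσ ζ (n + 1)] (ζ n) :=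
  Measurable.of_comap_le
    (le_iSup₂_of_le (f := fun i (_ : i ∈ Set.Iio (n + 1)) =>
      MeasurableSpace.comap (ζ i) inferInstance) n (Nat.lt_succ_self n) le_rfl)

omit [IsProbabilityMeasure μ] in
lemma indepFun_of_measurable_pastσ (hζ : ∀ i, Measurable (ζ i)) (hind : iIndepFun ζ μ) {n : ℕ}
    {T : Type*} [MeasurableSpace T] {U : Ω → T} (hU : Measurable[pastσ ζ n] U) :
    IndepFun U (ζ n) μ := by
  have h := indep_iSup_of_disjoint (fun i => (hζ i).comap_le) hind.iIndep
    (S := Set.Iio n) (T := {n}) (by simp)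
  simp only [Set.mem_singleton_iff, iSup_iSup_eq_left] at h
  rw [IndepFun_iff_Indep]
  exact indep_of_indep_of_le_left h hU.comap_le

/-- The supermartingale argument, by induction on n: the last factor is integrated first, given the
partial sum and `U n`, which both depend only on earlier samples. -/
lemma lintegral_exp_sum_le (hζ : ∀ i, Measurable (ζ i)) (hind : iIndepFun ζ μ)
    (hmap : ∀ i, μ.map (ζ i) = P) {U : ℕ → Ω → S} (hU : ∀ i, Measurable[pastσ ζ i] (U i))
    {Φ : ℕ → S × Ξ → ℝ} (hΦ : ∀ i, Measurable (Φ i)) {c : ℕ → ℝ} {n : ℕ}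
    (hc : ∀ i < n, ∀ ω, ∫⁻ z, ENNReal.ofReal (Real.exp (Φ i (U i ω, z))) ∂P ≤
      ENNReal.ofReal (Real.exp (c i))) :
    ∫⁻ ω, ENNReal.ofReal (Real.exp (∑ i ∈ Finset.range n, Φ i (U i ω, ζ i ω))) ∂μ ≤
      ENNReal.ofReal (Real.exp (∑ i ∈ Finset.range n, c i)) := by
  have hZ : ∀ n, Measurable[pastσ ζ n]
      fun ω => ∑ i ∈ Finset.range n, Φ i (U i ω, ζ i ω) := by
    intro n
    refine Finset.measurable_sum _ fun i hi => (hΦ i).comp ?_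
    have hi' := Finset.mem_range.1 hi
    exact Measurable.prodMk ((hU i).mono (pastσ_mono ζ hi'.le) le_rfl)
      ((measurable_pastσ_succ ζ i).mono (pastσ_mono ζ hi') le_rfl)
  induction n with
  | zero => simp
  | succ n ih =>
    have hUn : Measurable[pastσ ζ n]
        fun ω => (∑ i ∈ Finset.range n, Φ i (U i ω, ζ i ω), U n ω) :=
      Measurable.prodMk (hZ n) (hU n)
    have h := lintegral_mul_le_of_indepFun
      (A := fun q : ℝ × S => ENNReal.ofReal (Real.exp q.1))
      (Ψ := fun q : (ℝ × S) × Ξ => ENNReal.ofReal (Real.exp (Φ n (q.1.2, q.2))))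
      (hUn.mono (pastσ_le hζ n) le_rfl) (hζ n) (indepFun_of_measurable_pastσ hζ hind hUn) (hmap n)
      (by fun_prop) (by have := hΦ n; fun_prop) (hc n (Nat.lt_succ_self n))
    simp only [Finset.sum_range_succ, Real.exp_add, ENNReal.ofReal_mul (Real.exp_pos _).le]
    refine h.trans ?_
    gcongr
    exact ih fun i hi => hc i (hi.trans (Nat.lt_succ_self n))

/-- Markov's inequality for the exponential of a sum. -/
lemma measure_le_of_lintegral_exp_le {Z : Ω → ℝ} (hZ : Measurable Z) {s L : ℝ}
    (h : ∫⁻ ω, ENNReal.ofReal (Real.exp (Z ω)) ∂μ ≤ ENNReal.ofReal (Real.exp s)) :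
    ENNReal.ofReal (1 - Real.exp (-L)) ≤ μ {ω | Z ω ≤ s + L} := by
  have hms : MeasurableSet {ω | Z ω ≤ s + L} := measurableSet_le hZ measurable_const
  have h1 : μ {ω | Z ω ≤ s + L}ᶜ ≤ ENNReal.ofReal (Real.exp (-L)) := by
    have h2 := meas_ge_le_lintegral_div (μ := μ) (f := fun ω => ENNReal.ofReal (Real.exp (Z ω)))
      (by fun_prop) (ε := ENNReal.ofReal (Real.exp (s + L)))
      (by simp [Real.exp_pos]) ENNReal.ofReal_ne_top
    refine (measure_mono fun ω hω => ?_).trans (h2.trans ((ENNReal.div_le_div_right h _).trans ?_))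
    · simp only [Set.mem_compl_iff, Set.mem_ofPred_eq, not_le] at hω
      exact ENNReal.ofReal_le_ofReal (Real.exp_le_exp.2 hω.le)
    · rw [← ENNReal.ofReal_div_of_pos (Real.exp_pos _), ← Real.exp_sub]
      simp
  have h3 := prob_compl_eq_one_sub (μ := μ) hms
  rw [h3] at h1
  rw [ENNReal.ofReal_sub _ (Real.exp_pos _).le, ENNReal.ofReal_one]
  exact tsub_le_iff_tsub_le.1 h1

end Independence

/-! ### Deterministic analysis of the proximal update. -/

section ProximalStep

variable {F : Type*} [NormedAddCommGroup F] [InnerProductSpace ℝ F]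

lemma norm_convex_comb_sub_sq (x y u : F) (θ : ℝ) :
    ‖(1 - θ) • x + θ • y - u‖ ^ 2 =
      (1 - θ) * ‖x - u‖ ^ 2 + θ * ‖y - u‖ ^ 2 - θ * (1 - θ) * ‖y - x‖ ^ 2 := by
  have h1 : (1 - θ) • x + θ • y - u = (1 - θ) • (x - u) + θ • (y - u) := by module
  have h2 : y - x = (y - u) - (x - u) := by abel
  rw [h1, h2, norm_add_sq_real, norm_sub_sq_real (y - u) (x - u), norm_smul, norm_smul,
    inner_smul_left, inner_smul_right, mul_pow, mul_pow, Real.norm_eq_abs, Real.norm_eq_abs,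
    sq_abs, sq_abs, real_inner_comm (x - u) (y - u)]
  simp only [conj_trivial]
  ring

variable {X : Set F} {r : F → ℝ} {c u v x y : F} {A B : ℝ}

/-- The gain (A + B)‖y - x‖² is the strong convexity of the objective. It is obtained without
derivatives of r: compare the minimizer with (1 - θ)x + θy, divide by θ and let θ tend to 0. -/
lemma add_sq_dist_le_of_isMinOn (hX : Convex ℝ X) (hr : ConvexOn ℝ Set.univ r) (hx : x ∈ X)
    (hmin : IsMinOn (fun y => r y + inner ℝ c y + A * ‖y - u‖ ^ 2 + B * ‖y - v‖ ^ 2) X x)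
    (hy : y ∈ X) :
    r x + inner ℝ c x + A * ‖x - u‖ ^ 2 + B * ‖x - v‖ ^ 2 + (A + B) * ‖y - x‖ ^ 2 ≤
      r y + inner ℝ c y + A * ‖y - u‖ ^ 2 + B * ‖y - v‖ ^ 2 := by
  set Q := r y + inner ℝ c y + A * ‖y - u‖ ^ 2 + B * ‖y - v‖ ^ 2
    - (r x + inner ℝ c x + A * ‖x - u‖ ^ 2 + B * ‖x - v‖ ^ 2) with hQ
  have hθ : ∀ θ : ℝ, 0 < θ → θ < 1 → (A + B) * ‖y - x‖ ^ 2 * (1 - θ) ≤ Q := by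
    intro θ h0 h1
    have hz : (1 - θ) • x + θ • y ∈ X := hX hx hy (by linarith) h0.le (by ring)
    have h2 := hmin hz
    simp only [Set.mem_ofPred_eq] at h2
    have h3 := hr.2 (Set.mem_univ x) (Set.mem_univ y) (by linarith : 0 ≤ 1 - θ) h0.le (by ring)
    rw [norm_convex_comb_sub_sq, norm_convex_comb_sub_sq, inner_add_right, inner_smul_right,
      inner_smul_right] at h2
    simp only [smul_eq_mul] at h3
    have h4 : θ * ((A + B) * ‖y - x‖ ^ 2 * (1 - θ)) ≤ θ * Q := by
      rw [hQ]
      linarith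
    exact le_of_mul_le_mul_left h4 h0
  have hlim : Filter.Tendsto (fun θ : ℝ => (A + B) * ‖y - x‖ ^ 2 * (1 - θ))
      (nhdsWithin 0 (Set.Ioi 0)) (nhds ((A + B) * ‖y - x‖ ^ 2 * (1 - 0))) :=
    (Continuous.tendsto (by fun_prop) 0).mono_left nhdsWithin_le_nhds
  have h := le_of_tendsto hlim (by
    filter_upwards [Ioo_mem_nhdsGT (zero_lt_one' ℝ)] with θ hθ'
    exact hθ θ hθ'.1 hθ'.2)
  rw [sub_zero, mul_one] at h
  linarith

/-- Add the strong convexity inequalities of the two minimizers, each tested at the other one; r and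
the common anchor v cancel. This Lipschitz dependence on c - 2Au is the source of the measurability
of the iterates. -/
lemma norm_sub_le_of_isMinOn {c' u' x' : F} (hX : Convex ℝ X) (hr : ConvexOn ℝ Set.univ r)
    (hx : x ∈ X) (hx' : x' ∈ X)
    (hmin : IsMinOn (fun y => r y + inner ℝ c y + A * ‖y - u‖ ^ 2 + B * ‖y - v‖ ^ 2) X x)
    (hmin' : IsMinOn (fun y => r y + inner ℝ c' y + A * ‖y - u'‖ ^ 2 + B * ‖y - v‖ ^ 2) X x') :
    2 * (A + B) * ‖x - x'‖ ≤ ‖(c - (2 * A) • u) - (c' - (2 * A) • u')‖ := by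
  have h1 := add_sq_dist_le_of_isMinOn hX hr hx hmin hx'
  have h2 := add_sq_dist_le_of_isMinOn hX hr hx' hmin' hx
  set q := (c - (2 * A) • u) - (c' - (2 * A) • u') with hq
  have h3 : 2 * (A + B) * ‖x - x'‖ ^ 2 ≤ inner ℝ q (x' - x) := by
    have e1 : inner ℝ q (x' - x) = inner ℝ c x' - inner ℝ c x - inner ℝ c' x' + inner ℝ c' x
        - 2 * A * (inner ℝ u x' - inner ℝ u x) + 2 * A * (inner ℝ u' x' - inner ℝ u' x) := by
      simp only [hq, inner_sub_left, inner_sub_right, inner_smul_left, conj_trivial]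
      ring
    rw [norm_sub_rev x' x] at h1
    rw [norm_sub_sq_real x u, norm_sub_sq_real x' u] at h1
    rw [norm_sub_sq_real x u', norm_sub_sq_real x' u'] at h2
    rw [e1, real_inner_comm x u, real_inner_comm x' u, real_inner_comm x u', real_inner_comm x' u']
    linarith
  have h4 : inner ℝ q (x' - x) ≤ ‖q‖ * ‖x - x'‖ := by
    rw [norm_sub_rev x x']
    exact real_inner_le_norm _ _
  rcases (norm_nonneg (x - x')).eq_or_lt with h0 | h0
  · rw [← h0, mul_zero]
    exact norm_nonneg _
  · refine le_of_mul_le_mul_right ?_ h0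
    linarith

variable {f : F → ℝ} {f' : F → F} {G : ℝ} {x₁ xstar : F}

/-- One step of stabilized mirror descent with an inexact subgradient `c`. -/
lemma stabilized_step_le {η η' : ℝ} {xt xs : F} (hX : Convex ℝ X) (hr : ConvexOn ℝ Set.univ r)
    (hf : ∀ y ∈ X, ∀ z, f y + inner ℝ (f' y) (z - y) ≤ f z) (hf' : ∀ y ∈ X, ‖f' y‖ ≤ G)
    (hη : 0 < η) (hη' : 0 < η') (hηη' : η' ≤ η) (hxt : xt ∈ X) (hxs : xs ∈ X) (hstar : xstar ∈ X)
    (hmin : IsMinOn (fun y => r y + inner ℝ c y + ‖y - xt‖ ^ 2 / (2 * η)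
      + (η / η' - 1) * ‖y - x₁‖ ^ 2 / (2 * η)) X xs) :
    (f xs + r xs) - (f xstar + r xstar) + ‖xstar - xs‖ ^ 2 / (2 * η') ≤
      ‖xstar - xt‖ ^ 2 / (2 * η) + (1 / (2 * η') - 1 / (2 * η)) * ‖xstar - x₁‖ ^ 2
        + (inner ℝ (xstar - xt) (c - f' xt) + η * ‖c - f' xt‖ ^ 2 + 4 * η * G ^ 2) := by
  have hB : (η / η' - 1) / (2 * η) = 1 / (2 * η') - 1 / (2 * η) := by field_simp
  have hB0 : 0 ≤ 1 / (2 * η') - 1 / (2 * η) := by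
    rw [sub_nonneg]
    gcongr
  have hmin2 : IsMinOn (fun y => r y + inner ℝ c y + 1 / (2 * η) * ‖y - xt‖ ^ 2
      + (1 / (2 * η') - 1 / (2 * η)) * ‖y - x₁‖ ^ 2) X xs := by
    convert hmin using 2 with y
    rw [← hB]
    ring
  have h1 := add_sq_dist_le_of_isMinOn hX hr hxs hmin2 hstar
  have h2 := hf xs hxs xt
  have h3 := hf xt hxt xstar
  have h4 : inner ℝ (f' xs) (xs - xt) ≤ G * ‖xs - xt‖ :=
    (real_inner_le_norm _ _).trans (by gcongr; exact hf' xs hxs)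
  have h5 : -(G * ‖xs - xt‖) ≤ inner ℝ (f' xt) (xs - xt) := by
    have := (abs_le.1 (abs_real_inner_le_norm (f' xt) (xs - xt))).1
    have h6 : ‖f' xt‖ * ‖xs - xt‖ ≤ G * ‖xs - xt‖ := by gcongr; exact hf' xt hxt
    linarith
  have h6 : -(‖c - f' xt‖ * ‖xs - xt‖) ≤ inner ℝ (c - f' xt) (xs - xt) :=
    (abs_le.1 (abs_real_inner_le_norm (c - f' xt) (xs - xt))).1
  have e1 : inner ℝ (xstar - xt) (c - f' xt) = inner ℝ c xstar - inner ℝ c xs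
      - inner ℝ (f' xt) (xstar - xt) + inner ℝ (f' xt) (xs - xt)
      + inner ℝ (c - f' xt) (xs - xt) := by
    rw [real_inner_comm]
    simp only [inner_sub_left, inner_sub_right]
    ring
  have e2 : inner ℝ (f' xs) (xt - xs) = - inner ℝ (f' xs) (xs - xt) := by
    rw [← inner_neg_right, neg_sub]
  set δ := ‖xs - xt‖
  set e := ‖c - f' xt‖
  -- Half of the proximal term δ²/(2η) absorbs 2Gδ, the difference of the subgradients at `xs` and
  -- `xt`, and the other half absorbs the noise eδ.
  have h7 : 2 * G * δ + e * δ ≤ 1 / (2 * η) * δ ^ 2 + (η * e ^ 2 + 4 * η * G ^ 2) := by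
    have h8 : 0 ≤ (δ - 4 * η * G) ^ 2 / (4 * η) + (δ - 2 * η * e) ^ 2 / (4 * η) := by positivity
    have h9 : (δ - 4 * η * G) ^ 2 / (4 * η) + (δ - 2 * η * e) ^ 2 / (4 * η) =
        1 / (2 * η) * δ ^ 2 + (η * e ^ 2 + 4 * η * G ^ 2) - (2 * G * δ + e * δ) := by
      field_simp
      ring
    linarith
  have h10 : 0 ≤ (1 / (2 * η') - 1 / (2 * η)) * ‖xs - x₁‖ ^ 2 := by positivity
  have e3 : (1 / (2 * η) + (1 / (2 * η') - 1 / (2 * η))) * ‖xstar - xs‖ ^ 2 =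
      ‖xstar - xs‖ ^ 2 / (2 * η') := by ring
  have e4 : 1 / (2 * η) * ‖xstar - xt‖ ^ 2 = ‖xstar - xt‖ ^ 2 / (2 * η) := by ring
  linarith

/-- The regret of stabilized mirror descent with inexact subgradients `c t`. -/
lemma stabilized_regret_le {η : ℕ → ℝ} {xs c : ℕ → F} (hX : Convex ℝ X)
    (hr : ConvexOn ℝ Set.univ r)
    (hf : ∀ y ∈ X, ∀ z, f y + inner ℝ (f' y) (z - y) ≤ f z) (hf' : ∀ y ∈ X, ‖f' y‖ ≤ G)
    (hη : ∀ t, 1 ≤ t → 0 < η t) (hη' : ∀ t, 1 ≤ t → η (t + 1) ≤ η t)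
    (hxs : ∀ t, 1 ≤ t → xs t ∈ X) (hx₁ : xs 1 = x₁) (hstar : xstar ∈ X)
    (hmin : ∀ t, 1 ≤ t → IsMinOn (fun y => r y + inner ℝ (c t) y + ‖y - xs t‖ ^ 2 / (2 * η t)
      + (η t / η (t + 1) - 1) * ‖y - x₁‖ ^ 2 / (2 * η t)) X (xs (t + 1))) (t : ℕ) :
    ∑ s ∈ Finset.Icc 1 t, ((f (xs (s + 1)) + r (xs (s + 1))) - (f xstar + r xstar))
        + ‖xstar - xs (t + 1)‖ ^ 2 / (2 * η (t + 1)) ≤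
      ‖xstar - x₁‖ ^ 2 / (2 * η (t + 1)) + ∑ s ∈ Finset.Icc 1 t,
        (inner ℝ (xstar - xs s) (c s - f' (xs s)) + η s * ‖c s - f' (xs s)‖ ^ 2
          + 4 * η s * G ^ 2) := by
  induction t with
  | zero => simp [hx₁]
  | succ t ih =>
    have ht : 1 ≤ t + 1 := by omega
    have h := stabilized_step_le hX hr hf hf' (hη _ ht) (hη (t + 1 + 1) (by omega)) (hη' _ ht)
      (hxs _ ht) (hxs (t + 1 + 1) (by omega)) hstar (hmin _ ht)
    rw [Finset.sum_Icc_succ_top ht, Finset.sum_Icc_succ_top ht]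
    have e : (1 / (2 * η (t + 1 + 1)) - 1 / (2 * η (t + 1))) * ‖xstar - x₁‖ ^ 2 =
      ‖xstar - x₁‖ ^ 2 / (2 * η (t + 1 + 1)) - ‖xstar - x₁‖ ^ 2 / (2 * η (t + 1)) := by ring
    linarith

end ProximalStep

lemma sum_Icc_one_eq_sum_range {M : Type*} [AddCommMonoid M] (h : ℕ → M) (n : ℕ) :
    ∑ s ∈ Finset.Icc 1 n, h s = ∑ i ∈ Finset.range n, h (i + 1) := by
  induction n with
  | zero => simp
  | succ n ih => rw [Finset.sum_Icc_succ_top (by omega), Finset.sum_range_succ, ih]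

/-! ### Measurability of the iterates and of the stopped weights. -/

section Measurability

variable {d : ℕ} {Ω : Type*}

/-- A random vector that depends on a measurable one in a Lipschitz way is measurable. -/
lemma measurable_of_norm_sub_le {m : MeasurableSpace Ω} {q y : Ω → EuclideanSpace ℝ (Fin d)}
    (hq : Measurable q) (K : NNReal) (h : ∀ ω ω', ‖y ω - y ω'‖ ≤ K * ‖q ω - q ω'‖) :
    Measurable y := by
  have hfac : y.FactorsThrough q := fun ω ω' hω => by
    have := h ω ω'
    rw [hω, sub_self, norm_zero, mul_zero] at this
    exact sub_eq_zero.1 (norm_le_zero_iff.1 this)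
  -- Since y factors through q, it is a Lipschitz function on the range of q; the default value 0
  -- outside that range is irrelevant, as a Lipschitz extension to the whole space is taken next.
  have hL : LipschitzOnWith K (Function.extend q y 0) (Set.range q) := by
    refine LipschitzOnWith.of_dist_le_mul ?_
    rintro _ ⟨ω, rfl⟩ _ ⟨ω', rfl⟩
    rw [hfac.extend_apply, hfac.extend_apply, dist_eq_norm, dist_eq_norm]
    exact h ω ω'
  obtain ⟨e, he, heq⟩ := hL.extend_finite_dimension
  have hy : y = e ∘ q := by
    funext ω
    rw [Function.comp_apply, ← heq ⟨ω, rfl⟩, hfac.extend_apply]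
  rw [hy]
  exact he.continuous.measurable.comp hq

open Classical in
lemma measurable_ite_forall_norm_sub_le {m : MeasurableSpace Ω}
    {y : ℕ → Ω → EuclideanSpace ℝ (Fin d)} {v : Ω → EuclideanSpace ℝ (Fin d)}
    {a : EuclideanSpace ℝ (Fin d)} {b : ℕ → ℝ} {s : Finset ℕ} (hy : ∀ u ∈ s, Measurable (y u))
    (hv : Measurable v) :
    Measurable fun ω => if ∀ u ∈ s, ‖a - y u ω‖ ≤ b u then v ω else 0 := by
  refine Measurable.ite ?_ hv measurable_const
  have hset : {ω | ∀ u ∈ s, ‖a - y u ω‖ ≤ b u} = ⋂ u ∈ s, {ω | ‖a - y u ω‖ ≤ b u} := by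
    ext ω
    simp
  rw [hset]
  exact Finset.measurableSet_biInter _ fun u hu =>
    measurableSet_le (measurable_const.sub (hy u hu)).norm measurable_const

variable {Ξ : Type*} {X : Set (EuclideanSpace ℝ (Fin d))}
  {r : EuclideanSpace ℝ (Fin d) → ℝ} {g : EuclideanSpace ℝ (Fin d) → Ξ → EuclideanSpace ℝ (Fin d)}
  {x₁ : EuclideanSpace ℝ (Fin d)} {η τ : ℕ → ℝ} {ξ : ℕ → Ω → Ξ}
  {x : ℕ → Ω → EuclideanSpace ℝ (Fin d)}

lemma IsStabilizedClippedSGD.mem_of_one_le (h : IsStabilizedClippedSGD X r g x₁ η τ ξ x)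
    (hx₁ : x₁ ∈ X) {t : ℕ} (ht : 1 ≤ t) (ω : Ω) : x t ω ∈ X := by
  obtain ⟨n, rfl⟩ := Nat.exists_eq_add_of_le' ht
  rcases Nat.eq_zero_or_pos n with rfl | hn
  · rw [zero_add, h.init]
    exact hx₁
  · exact h.mem n hn ω

lemma IsStabilizedClippedSGD.measurable [MeasurableSpace Ξ]
    (h : IsStabilizedClippedSGD X r g x₁ η τ ξ x)
    (hX : Convex ℝ X) (hr : ConvexOn ℝ Set.univ r) (hx₁ : x₁ ∈ X)
    (hg : Measurable fun z : X × Ξ => g z.1 z.2) (hη : ∀ t, 1 ≤ t → 0 < η t) (n : ℕ) :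
    -- With the shift by one, `pastσ` at n is generated by ξ_1, …, ξ_n, which are exactly the
    -- samples that determine x_{n+1}.
    Measurable[pastσ (fun i => ξ (i + 1)) n] (x (n + 1)) := by
  induction n with
  | zero =>
    rw [show x (0 + 1) = fun _ => x₁ from funext h.init]
    exact measurable_const
  | succ n ih =>
    have h1 : 1 ≤ n + 1 := by omega
    have hx := ih.mono (pastσ_mono (fun i => ξ (i + 1)) n.le_succ) le_rfl
    have hgx : Measurable[pastσ (fun i => ξ (i + 1)) (n + 1)]
        fun ω => g (x (n + 1) ω) (ξ (n + 1) ω) :=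
      hg.comp (Measurable.prodMk (hx.subtype_mk (h := h.mem_of_one_le hx₁ h1))
        (measurable_pastσ_succ (fun i => ξ (i + 1)) n))
    set a := 1 / (2 * η (n + 1)) with ha
    set b := 1 / (2 * η (n + 1 + 1)) - 1 / (2 * η (n + 1)) with hb
    have hη1 := hη _ h1
    have hη2 := hη (n + 1 + 1) (by omega)
    have hab : (η (n + 1) / η (n + 1 + 1) - 1) / (2 * η (n + 1)) = b := by
      rw [hb]
      field_simp
    have hmin : ∀ ω, IsMinOn (fun y => r y + inner ℝ (clip (τ (n + 1)) (g (x (n + 1) ω)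
        (ξ (n + 1) ω))) y + a * ‖y - x (n + 1) ω‖ ^ 2 + b * ‖y - x₁‖ ^ 2) X
        (x (n + 1 + 1) ω) := by
      intro ω
      convert h.argmin _ h1 ω using 2 with y
      rw [← hab]
      ring
    refine measurable_of_norm_sub_le
      (q := fun ω => clip (τ (n + 1)) (g (x (n + 1) ω) (ξ (n + 1) ω)) - (2 * a) • x (n + 1) ω)
      (((measurable_clip _).comp hgx).sub (hx.const_smul (2 * a))) (η (n + 1 + 1)).toNNReal
      fun ω ω' => ?_
    have hle := norm_sub_le_of_isMinOn hX hr (h.mem _ h1 ω) (h.mem _ h1 ω') (hmin ω) (hmin ω')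
    have h2 : 2 * (a + b) = 1 / η (n + 1 + 1) := by
      rw [ha, hb]
      field_simp
      ring
    rw [h2, one_div, ← div_eq_inv_mul, div_le_iff₀ hη2, mul_comm] at hle
    rw [Real.coe_toNNReal _ hη2.le]
    exact hle

end Measurability

/-! ### High-probability regret bound by stopping. -/

section Regret

variable {d : ℕ} {X : Set (EuclideanSpace ℝ (Fin d))} {f r : EuclideanSpace ℝ (Fin d) → ℝ}
  {f' : EuclideanSpace ℝ (Fin d) → EuclideanSpace ℝ (Fin d)}
  {xstar x₁ : EuclideanSpace ℝ (Fin d)} {G : ℝ}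
  {Ξ : Type*} [MeasurableSpace Ξ] {P : Measure Ξ} [IsProbabilityMeasure P]
  {g : EuclideanSpace ℝ (Fin d) → Ξ → EuclideanSpace ℝ (Fin d)}
  {Ω : Type*} [MeasurableSpace Ω] {μ : Measure Ω} [IsProbabilityMeasure μ]
  {ξ : ℕ → Ω → Ξ} {x : ℕ → Ω → EuclideanSpace ℝ (Fin d)} {η τ B V W : ℕ → ℝ}

/-- What the stepsizes, the thresholds and the moment bounds have to satisfy up to time `T`,
relative to `R = D² / η_{T+1}`. -/
structure IsAdmissible (η τ B V W : ℕ → ℝ) (G L R A : ℝ) (T : ℕ) : Prop where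
  threshold : ∀ t ∈ Finset.Icc 1 T, η t * τ t ^ 2 * L ^ 2 ≤ 4 * R
  bias : ∑ t ∈ Finset.Icc 1 T, √(η t) * B t ≤ A * √R
  variance_inner : L * ∑ t ∈ Finset.Icc 1 T, η t * V t ≤ A * R
  variance_norm : ∑ t ∈ Finset.Icc 1 T, η t * W t ≤ A * R
  gradient : ∑ t ∈ Finset.Icc 1 T, 4 * η t * G ^ 2 ≤ A * R

/-- Deviation bound for the stopped error terms. The weights `w` are predictable. -/
lemma stopped_error_le {w : ℕ → Ω → EuclideanSpace ℝ (Fin d)} {L R A k : ℝ} {T : ℕ}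
    (hG : 0 < G) (hf' : ∀ y ∈ X, ‖f' y‖ ≤ G) (hf'm : Measurable fun y : X => f' y)
    (hgm : Measurable fun z : X × Ξ => g z.1 z.2) (hgi : ∀ y ∈ X, Integrable (g y) P)
    (hξ : ∀ t, 1 ≤ t → Measurable (ξ t)) (hP : ∀ t, 1 ≤ t → μ.map (ξ t) = P)
    (hind : iIndepFun (fun t : ℕ => ξ (t + 1)) μ)
    (hη : ∀ t, 1 ≤ t → 0 < η t) (hτ : ∀ t, 1 ≤ t → 2 * G ≤ τ t)
    (hE : ∀ t, 1 ≤ t → ClipErrorBound X f' g P (τ t) (B t) (V t) (W t))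
    (hB : ∀ t, 1 ≤ t → 0 ≤ B t) (hV : ∀ t, 1 ≤ t → 0 ≤ V t)
    (hL : 1 ≤ L) (hR : 0 < R) (hk : 3 ≤ k) (hA : IsAdmissible η τ B V W G L R A T)
    (hxX : ∀ t, 1 ≤ t → ∀ ω, x t ω ∈ X)
    (hx : ∀ n, Measurable[pastσ (fun i => ξ (i + 1)) n] (x (n + 1)))
    (hw : ∀ n, Measurable[pastσ (fun i => ξ (i + 1)) n] (w (n + 1)))
    (hwle : ∀ t, 1 ≤ t → ∀ ω, ‖w t ω‖ ≤ k * (√(η t) * √R)) :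
    ENNReal.ofReal (1 - Real.exp (-L)) ≤ μ {ω | ∑ t ∈ Finset.Icc 1 T,
      (inner ℝ (w t ω) (clip (τ t) (g (x t ω) (ξ t ω)) - f' (x t ω))
        + η t * ‖clip (τ t) (g (x t ω) (ξ t ω)) - f' (x t ω)‖ ^ 2) ≤
      (k * (4 / 3 * A + 6) + 3 * A) * R} := by
  have hk0 : 0 < k := by linarith
  have hL0 : 0 < L := by linarith
  -- The largest scale at which the threshold condition ητ²L² ≤ 4R is seen to keep the linear
  -- exponent below 1/2. The Markov term is then L/θ = 6kR, again a multiple of R.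
  set θ := L / (6 * k * R) with hθ
  have hθ0 : 0 < θ := by positivity
  have hsq : √R * √R = R := Real.mul_self_sqrt hR.le
  set Φ : ℕ → (X × EuclideanSpace ℝ (Fin d)) × Ξ → ℝ := fun i q =>
    θ * (inner ℝ q.1.2 (clip (τ (i + 1)) (g q.1.1 q.2) - f' q.1.1)
      + η (i + 1) * ‖clip (τ (i + 1)) (g q.1.1 q.2) - f' q.1.1‖ ^ 2) with hΦ
  set U : ℕ → Ω → X × EuclideanSpace ℝ (Fin d) := fun i ω =>
    (⟨x (i + 1) ω, hxX _ (by omega) ω⟩, w (i + 1) ω) with hU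
  set c : ℕ → ℝ := fun i => θ * (k * (√(η (i + 1)) * √R) * B (i + 1))
    + 2 * θ ^ 2 * ((k * (√(η (i + 1)) * √R)) ^ 2 * V (i + 1))
    + 3 * θ * (η (i + 1) * W (i + 1)) with hc
  have hUm : ∀ i, Measurable[pastσ (fun i => ξ (i + 1)) i] (U i) := fun i =>
    Measurable.prodMk ((hx i).subtype_mk (h := hxX _ (by omega))) (hw i)
  have hΦm : ∀ i, Measurable (Φ i) := by
    intro i
    have h1 : Measurable fun q : (X × EuclideanSpace ℝ (Fin d)) × Ξ =>
        clip (τ (i + 1)) (g q.1.1 q.2) - f' q.1.1 :=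
      ((measurable_clip _).comp (hgm.comp
        ((measurable_fst.comp measurable_fst).prodMk measurable_snd))).sub
        (hf'm.comp (measurable_fst.comp measurable_fst))
    exact (((measurable_snd.comp measurable_fst).inner h1).add
      ((h1.norm.pow_const 2).const_mul _)).const_mul _
  have hone : ∀ i < T, ∀ ω, ∫⁻ z, ENNReal.ofReal (Real.exp (Φ i (U i ω, z))) ∂P ≤
      ENNReal.ofReal (Real.exp (c i)) := by
    intro i hi ω
    have h1 : 1 ≤ i + 1 := by omega
    have hth := hA.threshold (i + 1) (Finset.mem_Icc.2 ⟨h1, hi⟩)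
    have hη1 := hη _ h1
    have hτ1 := hτ _ h1
    have hτ0 : 0 < τ (i + 1) := by linarith
    have hτw : √(η (i + 1)) * √R * τ (i + 1) * L ≤ 2 * R := by
      refine (sq_le_sq₀ (by positivity) (by positivity)).1 ?_
      calc (√(η (i + 1)) * √R * τ (i + 1) * L) ^ 2
          = √(η (i + 1)) ^ 2 * √R ^ 2 * τ (i + 1) ^ 2 * L ^ 2 := by ring
        _ = R * (η (i + 1) * τ (i + 1) ^ 2 * L ^ 2) := by
          rw [Real.sq_sqrt hη1.le, Real.sq_sqrt hR.le]
          ring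
        _ ≤ R * (4 * R) := by gcongr
        _ = (2 * R) ^ 2 := by ring
    have hwθ : θ * (‖w (i + 1) ω‖ * (3 / 2 * τ (i + 1))) ≤ 1 / 2 := by
      calc θ * (‖w (i + 1) ω‖ * (3 / 2 * τ (i + 1)))
          ≤ θ * (k * (√(η (i + 1)) * √R) * (3 / 2 * τ (i + 1))) := by
            gcongr
            exact hwle _ h1 ω
        _ = (√(η (i + 1)) * √R * τ (i + 1) * L) / (4 * R) := by
            rw [hθ]
            field_simp
            norm_num
        _ ≤ 2 * R / (4 * R) := by gcongr
        _ = 1 / 2 := by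
            field_simp
            norm_num
    have hτθ : θ * (η (i + 1) * (3 / 2 * τ (i + 1)) ^ 2) ≤ 1 / 2 := by
      calc θ * (η (i + 1) * (3 / 2 * τ (i + 1)) ^ 2)
          = 3 / 8 * (η (i + 1) * τ (i + 1) ^ 2 * L ^ 2) / (k * R * L) := by
            rw [hθ]
            field_simp
            norm_num
        _ ≤ 3 / 8 * (4 * R) / (k * R * L) := by gcongr
        _ = 3 / 2 / (k * L) := by
            field_simp
            norm_num
        _ ≤ 3 / 2 / (3 * 1) := by gcongr
        _ = 1 / 2 := by norm_num
    refine ((hE _ h1).lintegral_exp_le (hxX _ h1 ω) (hgi _ (hxX _ h1 ω)) hG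
      (hf' _ (hxX _ h1 ω)) hτ1 hθ0.le hη1.le hwθ hτθ).trans ?_
    apply ENNReal.ofReal_le_ofReal
    apply Real.exp_le_exp.2
    have h2 := hwle _ h1 ω
    have h3 := hB _ h1
    have h4 := hV _ h1
    simp only [hc]
    gcongr
  have hexp := lintegral_exp_sum_le (P := P) (fun i => hξ (i + 1) (by omega)) hind
    (fun i => hP (i + 1) (by omega)) hUm hΦm hone
  have hmeas : Measurable fun ω => ∑ i ∈ Finset.range T, Φ i (U i ω, ξ (i + 1) ω) := by
    refine Finset.measurable_sum _ fun i _ => (hΦm i).comp ?_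
    exact ((hUm i).mono (pastσ_le (fun i => hξ (i + 1) (by omega)) i) le_rfl).prodMk
      (hξ (i + 1) (by omega))
  refine (measure_le_of_lintegral_exp_le hmeas (L := L) hexp).trans (measure_mono fun ω hω => ?_)
  simp only [Set.mem_ofPred_eq] at hω ⊢
  -- After division by θ: the bias gives kAR, the directional variance kAR/3 (because 2θk²R = kL/3),
  -- the total variance 3AR and Markov's inequality 6kR.
  have hsumc : ∑ i ∈ Finset.range T, c i + L ≤ θ * ((k * (4 / 3 * A + 6) + 3 * A) * R) := by
    have e1 : ∑ i ∈ Finset.range T, c i = θ * (k * √R *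
        (∑ t ∈ Finset.Icc 1 T, √(η t) * B t) + k / 3 * (L * ∑ t ∈ Finset.Icc 1 T, η t * V t)
        + 3 * ∑ t ∈ Finset.Icc 1 T, η t * W t) := by
      rw [← sum_Icc_one_eq_sum_range (fun t => θ * (k * (√(η t) * √R) * B t)
        + 2 * θ ^ 2 * ((k * (√(η t) * √R)) ^ 2 * V t) + 3 * θ * (η t * W t)), Finset.mul_sum,
        Finset.mul_sum, Finset.mul_sum, Finset.mul_sum,
        ← Finset.sum_add_distrib, ← Finset.sum_add_distrib, Finset.mul_sum]
      refine Finset.sum_congr rfl fun t ht => ?_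
      have h1 : (k * (√(η t) * √R)) ^ 2 = k ^ 2 * (η t * R) := by
        rw [mul_pow, mul_pow, Real.sq_sqrt (hη t (Finset.mem_Icc.1 ht).1).le, Real.sq_sqrt hR.le]
      have h2 : θ * (6 * k * R) = L := by
        rw [hθ]
        field_simp
      rw [h1, ← h2]
      ring
    have e2 : L = θ * (6 * k * R) := by
      rw [hθ]
      field_simp
    calc ∑ i ∈ Finset.range T, c i + L
        ≤ θ * (k * √R * (A * √R) + k / 3 * (A * R) + 3 * (A * R)) + L := by
          have h1 := mul_le_mul_of_nonneg_left hA.bias (by positivity : 0 ≤ k * √R)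
          have h2 := mul_le_mul_of_nonneg_left hA.variance_inner (by positivity : 0 ≤ k / 3)
          have h3 := hA.variance_norm
          rw [e1]
          gcongr θ * ?_ + L
          linarith
      _ = θ * (k * A * (√R * √R) + k / 3 * (A * R) + 3 * (A * R)) + θ * (6 * k * R) := by
          rw [← e2]
          ring
      _ = _ := by
          rw [hsq]
          ring
  have hsum : ∑ i ∈ Finset.range T, Φ i (U i ω, ξ (i + 1) ω) = θ * ∑ t ∈ Finset.Icc 1 T,
      (inner ℝ (w t ω) (clip (τ t) (g (x t ω) (ξ t ω)) - f' (x t ω))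
        + η t * ‖clip (τ t) (g (x t ω) (ξ t ω)) - f' (x t ω)‖ ^ 2) := by
    rw [sum_Icc_one_eq_sum_range, Finset.mul_sum]
  rw [hsum] at hω
  exact le_of_mul_le_mul_left (hω.trans hsumc) hθ0

/-- With high probability, the regret is of the order of `D² / η_{T+1}`. -/
theorem regret_le_of_isAdmissible {L A : ℝ} {T : ℕ}
    (hX : Convex ℝ X) (hstar : xstar ∈ X) (hmin : IsMinOn (fun y => f y + r y) X xstar)
    (hr : ConvexOn ℝ Set.univ r) (hf : ∀ y ∈ X, IsSubgradientAt f y (f' y))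
    (hG : 0 < G) (hf' : ∀ y ∈ X, ‖f' y‖ ≤ G) (hf'm : Measurable fun y : X => f' y)
    (hgm : Measurable fun z : X × Ξ => g z.1 z.2) (hgi : ∀ y ∈ X, Integrable (g y) P)
    (hx₁ : x₁ ∈ X) (hne : x₁ ≠ xstar)
    (hξ : ∀ t, 1 ≤ t → Measurable (ξ t)) (hP : ∀ t, 1 ≤ t → μ.map (ξ t) = P)
    (hind : iIndepFun (fun t : ℕ => ξ (t + 1)) μ)
    (hη : ∀ t, 1 ≤ t → 0 < η t) (hη' : ∀ s t, 1 ≤ s → s ≤ t → η t ≤ η s)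
    (hτ : ∀ t, 1 ≤ t → 2 * G ≤ τ t)
    (hE : ∀ t, 1 ≤ t → ClipErrorBound X f' g P (τ t) (B t) (V t) (W t))
    (hB : ∀ t, 1 ≤ t → 0 ≤ B t) (hV : ∀ t, 1 ≤ t → 0 ≤ V t)
    (hL : 1 ≤ L) (hA0 : 0 ≤ A)
    (hA : IsAdmissible η τ B V W G L (‖xstar - x₁‖ ^ 2 / η (T + 1)) A T)
    (hx : IsStabilizedClippedSGD X r g x₁ η τ ξ x) :
    ENNReal.ofReal (1 - Real.exp (-L)) ≤ μ {ω | ∑ t ∈ Finset.Icc 1 T,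
      ((f (x (t + 1) ω) + r (x (t + 1) ω)) - (f xstar + r xstar)) ≤
      (4 * A + 20) ^ 2 / 2 * (‖xstar - x₁‖ ^ 2 / η (T + 1))} := by
  classical
  set R := ‖xstar - x₁‖ ^ 2 / η (T + 1) with hRdef
  set k := 4 * A + 20 with hkdef
  have hD : 0 < ‖xstar - x₁‖ := norm_pos_iff.2 (sub_ne_zero.2 hne.symm)
  have hηT := hη (T + 1) (by omega)
  have hR : 0 < R := by positivity
  have hxX : ∀ t, 1 ≤ t → ∀ ω, x t ω ∈ X := fun t ht ω => hx.mem_of_one_le hx₁ ht ω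
  have hxm := hx.measurable hX hr hx₁ hgm hη
  -- The radius k√(η_u R) at time u is the one returned by the regret inequality, whose left side
  -- contains ‖x⋆ - x_u‖²/(2η_u). The weight at time t looks only at x_1, …, x_t and is therefore
  -- predictable.
  set good : ℕ → Ω → Prop := fun t ω =>
    ∀ u ∈ Finset.Icc 1 t, ‖xstar - x u ω‖ ≤ k * (√(η u) * √R) with hgood
  set w : ℕ → Ω → EuclideanSpace ℝ (Fin d) := fun t ω =>
    if good t ω then xstar - x t ω else 0 with hw
  have hwm : ∀ n, Measurable[pastσ (fun i => ξ (i + 1)) n] (w (n + 1)) := by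
    intro n
    refine measurable_ite_forall_norm_sub_le (fun u hu => ?_) (measurable_const.sub (hxm n))
    obtain ⟨hu1, hu2⟩ := Finset.mem_Icc.1 hu
    obtain ⟨v, rfl⟩ := Nat.exists_eq_add_of_le' hu1
    exact (hxm v).mono (pastσ_mono (fun i => ξ (i + 1)) (by omega : v ≤ n)) le_rfl
  have hwle : ∀ t, 1 ≤ t → ∀ ω, ‖w t ω‖ ≤ k * (√(η t) * √R) := by
    intro t ht ω
    by_cases h : good t ω
    · simp only [hw, if_pos h]
      exact h t (Finset.mem_Icc.2 ⟨ht, le_rfl⟩)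
    · simp only [hw, if_neg h, norm_zero]
      positivity
  refine (stopped_error_le hG hf' hf'm hgm hgi hξ hP hind hη hτ hE hB hV hL hR
    (by linarith : 3 ≤ k) hA hxX hxm hwm hwle).trans (measure_mono fun ω hω => ?_)
  simp only [Set.mem_ofPred_eq] at hω ⊢
  -- This inequality closes the bootstrap and dictates the choice of k: the initial distance, the
  -- errors and the gradient terms must fit into k²/2.
  have hkA : 1 / 2 + (k * (4 / 3 * A + 6) + 3 * A) + A ≤ k ^ 2 / 2 := by
    rw [hkdef]
    nlinarith
  have hreg := stabilized_regret_le (c := fun t => clip (τ t) (g (x t ω) (ξ t ω)))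
    (xs := fun t => x t ω) hX hr hf hf' hη
    (fun t ht => hη' t (t + 1) ht t.le_succ) (fun t ht => hxX t ht ω) (hx.init ω) hstar
    (fun t ht => hx.argmin t ht ω)
  have hgap : ∀ t, 1 ≤ t → 0 ≤ (f (x t ω) + r (x t ω)) - (f xstar + r xstar) := fun t ht =>
    sub_nonneg.2 (hmin (hxX t ht ω))
  -- The concentration event concerns the full stopped sum up to T only. If t is T or the last time
  -- before stopping, the terms after t have zero weight and reduce to η_s‖e_s‖² ≥ 0, so the partial
  -- sum up to t obeys the same bound.
  have hbound : ∀ t ≤ T, good t ω → (t = T ∨ ¬ good (t + 1) ω) →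
      ∑ s ∈ Finset.Icc 1 t, ((f (x (s + 1) ω) + r (x (s + 1) ω)) - (f xstar + r xstar))
        + ‖xstar - x (t + 1) ω‖ ^ 2 / (2 * η (t + 1)) ≤ k ^ 2 / 2 * R := by
    intro t ht hgt hor
    have hsub : Finset.Icc 1 t ⊆ Finset.Icc 1 T := Finset.Icc_subset_Icc_right ht
    have h1 : ∑ s ∈ Finset.Icc 1 t,
        (inner ℝ (xstar - x s ω) (clip (τ s) (g (x s ω) (ξ s ω)) - f' (x s ω))
          + η s * ‖clip (τ s) (g (x s ω) (ξ s ω)) - f' (x s ω)‖ ^ 2) ≤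
        (k * (4 / 3 * A + 6) + 3 * A) * R := by
      refine le_trans ?_ hω
      calc _ = ∑ s ∈ Finset.Icc 1 t,
            (inner ℝ (w s ω) (clip (τ s) (g (x s ω) (ξ s ω)) - f' (x s ω))
              + η s * ‖clip (τ s) (g (x s ω) (ξ s ω)) - f' (x s ω)‖ ^ 2) := by
            refine Finset.sum_congr rfl fun s hs => ?_
            have hgs : good s ω := fun u hu => hgt u
              (Finset.Icc_subset_Icc_right (Finset.mem_Icc.1 hs).2 hu)
            simp only [hw, if_pos hgs]
        _ ≤ _ := by
            refine Finset.sum_le_sum_of_subset_of_nonneg hsub fun s hs hs' => ?_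
            obtain ⟨hs1, hs2⟩ := Finset.mem_Icc.1 hs
            have hts : t < s := by
              by_contra hcon
              exact hs' (Finset.mem_Icc.2 ⟨hs1, not_lt.1 hcon⟩)
            have hng : ¬ good s ω := by
              rcases hor with rfl | hor
              · omega
              · exact fun hgs => hor fun u hu => hgs u (Finset.Icc_subset_Icc_right hts hu)
            simp only [hw, if_neg hng, inner_zero_left, zero_add]
            have := hη s hs1
            positivity
    have h2 : ∑ s ∈ Finset.Icc 1 t, 4 * η s * G ^ 2 ≤ A * R := by
      refine le_trans (Finset.sum_le_sum_of_subset_of_nonneg hsub fun s hs _ => ?_) hA.gradient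
      have := hη s (Finset.mem_Icc.1 hs).1
      positivity
    have h3 : ‖xstar - x₁‖ ^ 2 / (2 * η (t + 1)) ≤ 1 / 2 * R := by
      have h4 := hη' (t + 1) (T + 1) (by omega) (by omega)
      calc ‖xstar - x₁‖ ^ 2 / (2 * η (t + 1)) ≤ ‖xstar - x₁‖ ^ 2 / (2 * η (T + 1)) := by gcongr
        _ = 1 / 2 * R := by
          rw [hRdef]
          ring
    have h5 := hreg t
    rw [Finset.sum_add_distrib] at h5
    have h6 := mul_le_mul_of_nonneg_right hkA hR.le
    linarith
  -- A first failure could only come from x_{t+1}, but then `hbound` at t places x_{t+1} within the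
  -- allowed radius.
  have hall : ∀ t ≤ T, good t ω := by
    intro t
    induction t with
    | zero => intro _ u hu; simp at hu
    | succ t ih =>
      intro ht
      have hgt := ih (by omega)
      by_contra hcon
      have h1 := hbound t (by omega) hgt (Or.inr hcon)
      have h2 : 0 ≤ ∑ s ∈ Finset.Icc 1 t,
          ((f (x (s + 1) ω) + r (x (s + 1) ω)) - (f xstar + r xstar)) :=
        Finset.sum_nonneg fun s _ => hgap (s + 1) (by omega)
      have hη1 := hη (t + 1) (by omega)
      have h3 : ‖xstar - x (t + 1) ω‖ ^ 2 ≤ (k * (√(η (t + 1)) * √R)) ^ 2 := by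
        rw [mul_pow, mul_pow, Real.sq_sqrt hη1.le, Real.sq_sqrt hR.le]
        have h4 : ‖xstar - x (t + 1) ω‖ ^ 2 / (2 * η (t + 1)) ≤ k ^ 2 / 2 * R := by linarith
        rw [div_le_iff₀ (by positivity)] at h4
        linarith
      refine hcon fun u hu => ?_
      rcases (Finset.mem_Icc.1 hu).2.eq_or_lt with rfl | hlt
      · exact (sq_le_sq₀ (norm_nonneg _) (by positivity)).1 h3
      · exact hgt u (Finset.mem_Icc.2 ⟨(Finset.mem_Icc.1 hu).1, by omega⟩)
  have hfin := hbound T le_rfl (hall T le_rfl) (Or.inl rfl)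
  have : 0 ≤ ‖xstar - x (T + 1) ω‖ ^ 2 / (2 * η (T + 1)) := by positivity
  linarith

end Regret

/-! ### Sums over time. -/

section Sums

/-- By induction: Bernoulli's inequality for (1 - 1/(T+1))^b shows that each increment of T^b is at
least b(T+1)^(b-1). -/
lemma sum_rpow_sub_one_le {b : ℝ} (hb0 : 0 < b) (hb1 : b ≤ 1) (T : ℕ) :
    ∑ t ∈ Finset.Icc 1 T, (t : ℝ) ^ (b - 1) ≤ (T : ℝ) ^ b / b := by
  induction T with
  | zero => simp [Real.zero_rpow hb0.ne']
  | succ T ih =>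
    rw [Finset.sum_Icc_succ_top (by omega)]
    have hT : (0 : ℝ) < (T + 1 : ℕ) := by positivity
    have h1 : (T : ℝ) ^ b ≤ ((T + 1 : ℕ) : ℝ) ^ b - b * ((T + 1 : ℕ) : ℝ) ^ (b - 1) := by
      have h2 : (T : ℝ) = (T + 1 : ℕ) * (1 + -(1 / ((T + 1 : ℕ) : ℝ))) := by
        field_simp
        push_cast
        ring
      have h3 : -1 ≤ -(1 / ((T + 1 : ℕ) : ℝ)) := by
        rw [neg_le_neg_iff, div_le_one hT]
        push_cast
        linarith [(Nat.cast_nonneg T : (0 : ℝ) ≤ T)]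
      have h4 := rpow_one_add_le_one_add_mul_self h3 hb0.le hb1
      calc (T : ℝ) ^ b = ((T + 1 : ℕ) : ℝ) ^ b * (1 + -(1 / ((T + 1 : ℕ) : ℝ))) ^ b := by
            conv_lhs => rw [h2]
            exact Real.mul_rpow hT.le (by linarith)
        _ ≤ ((T + 1 : ℕ) : ℝ) ^ b * (1 + b * -(1 / ((T + 1 : ℕ) : ℝ))) := by gcongr
        _ = _ := by
            rw [Real.rpow_sub_one hT.ne']
            ring
    calc _ ≤ (T : ℝ) ^ b / b + ((T + 1 : ℕ) : ℝ) ^ (b - 1) := by gcongr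
      _ = ((T : ℝ) ^ b + b * ((T + 1 : ℕ) : ℝ) ^ (b - 1)) / b := by field_simp
      _ ≤ ((T + 1 : ℕ) : ℝ) ^ b / b := by
          gcongr
          linarith

lemma sum_ratio_rpow_div_le {b : ℝ} (hb0 : 0 < b) (hb1 : b ≤ 1) (T : ℕ) :
    ∑ t ∈ Finset.Icc 1 T, ((t : ℝ) / (T + 1 : ℕ)) ^ b / t ≤ 1 / b := by
  have hT : (0 : ℝ) < (T + 1 : ℕ) := by positivity
  calc ∑ t ∈ Finset.Icc 1 T, ((t : ℝ) / (T + 1 : ℕ)) ^ b / t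
      = (∑ t ∈ Finset.Icc 1 T, (t : ℝ) ^ (b - 1)) / ((T + 1 : ℕ) : ℝ) ^ b := by
        rw [Finset.sum_div]
        refine Finset.sum_congr rfl fun t ht => ?_
        have ht0 : (0 : ℝ) < t := by exact_mod_cast (Finset.mem_Icc.1 ht).1
        rw [Real.div_rpow ht0.le hT.le, Real.rpow_sub_one ht0.ne']
        ring
    _ ≤ ((T : ℝ) ^ b / b) / ((T + 1 : ℕ) : ℝ) ^ b := by
        gcongr
        exact sum_rpow_sub_one_le hb0 hb1 T
    _ ≤ (((T + 1 : ℕ) : ℝ) ^ b / b) / ((T + 1 : ℕ) : ℝ) ^ b := by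
        gcongr
        exact_mod_cast T.le_succ
    _ = 1 / b := by field_simp

lemma one_div_mul_sqrt_succ_le {t : ℝ} (ht : 0 < t) :
    1 / ((t + 1) * √(t + 1)) ≤ 2 / √t - 2 / √(t + 1) := by
  have h1 : 0 < √t := Real.sqrt_pos.2 ht
  have h2 : √t ≤ √(t + 1) := Real.sqrt_le_sqrt (by linarith)
  have h3 : √t ^ 2 = t := Real.sq_sqrt ht.le
  have h4 : √(t + 1) ^ 2 = t + 1 := Real.sq_sqrt (by linarith)
  set u := √t
  set v := √(t + 1)
  have hv : 0 < v := h1.trans_le h2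
  have h5 : 2 / u - 2 / v = 2 / (u * v * (u + v)) := by
    have : (v - u) * (u + v) = 1 := by linear_combination h4 - h3
    field_simp
    linarith
  rw [h5, ← h4, div_le_div_iff₀ (by positivity) (by positivity)]
  have h6 : u * (u + v) ≤ v * (v + v) := by gcongr
  nlinarith

lemma sum_Ioc_one_div_mul_sqrt_le {N : ℕ} (hN : 1 ≤ N) (T : ℕ) :
    ∑ t ∈ Finset.Ioc N T, 1 / ((t : ℝ) * √t) ≤ 2 / √N := by
  rcases le_or_gt T N with h | h
  · rw [Finset.Ioc_eq_empty_of_le h, Finset.sum_empty]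
    positivity
  · have key : ∑ t ∈ Finset.Ioc N T, 1 / ((t : ℝ) * √t) ≤ 2 / √N - 2 / √T := by
      induction T, h.le using Nat.le_induction with
      | base => simp
      | succ T hNT ih =>
        have hT : (0 : ℝ) < T := by exact_mod_cast hN.trans hNT
        rw [Finset.sum_Ioc_succ_top hNT]
        rcases hNT.eq_or_lt with rfl | hlt
        · have := one_div_mul_sqrt_succ_le hT
          push_cast
          simpa using this
        · have h1 := ih hlt
          have h2 := one_div_mul_sqrt_succ_le hT
          push_cast
          linarith
    have : 0 ≤ 2 / √(T : ℝ) := by positivity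
    linarith

/-- Bounding η_t by γ throughout would cost ln T, so the sum is cut at N = ⌈φ²⌉. Up to N, the
harmonic sum costs 1 + ln N ≤ 2 + 2 ln φ, which is the origin of ψ⋆. Beyond N, the bound c/√t leaves
a tail of at most 2c/√N ≤ 2c/φ, which cancels the factor φ. -/
lemma sum_stepsize_div_le {η : ℕ → ℝ} {γ c φ : ℝ} (hγ0 : 0 ≤ γ) (hc0 : 0 ≤ c) (hφ : 1 ≤ φ)
    (hη0 : ∀ t, 1 ≤ t → 0 ≤ η t)
    (hγ : ∀ t, 1 ≤ t → η t ≤ γ) (hc : ∀ t : ℕ, 1 ≤ t → η t ≤ c / √t) (T : ℕ) :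
    φ * ∑ t ∈ Finset.Icc 1 T, η t / t ≤ 2 * (γ * (φ * (1 + Real.log φ))) + 2 * c := by
  have hφ0 : 0 < φ := by linarith
  set N := ⌈φ ^ 2⌉₊ with hN
  have hN1 : 1 ≤ N := Nat.one_le_ceil_iff.2 (by positivity)
  have hNφ : φ ^ 2 ≤ N := Nat.le_ceil _
  have hNφ' : (N : ℝ) ≤ 2 * φ ^ 2 := by
    have := (Nat.ceil_lt_add_one (by positivity : 0 ≤ φ ^ 2)).le
    nlinarith
  have hN0 : (0 : ℝ) < N := by exact_mod_cast hN1
  have hlog : Real.log N ≤ 1 + 2 * Real.log φ := by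
    calc Real.log N ≤ Real.log (2 * φ ^ 2) := Real.log_le_log hN0 hNφ'
      _ = Real.log 2 + 2 * Real.log φ := by
        rw [Real.log_mul (by norm_num) (by positivity), Real.log_pow]
        norm_num
      _ ≤ 1 + 2 * Real.log φ := by linarith [Real.log_two_lt_d9]
  have hsqrt : φ ≤ √N := Real.le_sqrt_of_sq_le hNφ
  have hpos : ∀ t, 1 ≤ t → 0 ≤ η t / t := fun t ht => div_nonneg (hη0 t ht) (by positivity)
  have hsub : Finset.Icc 1 T ⊆ Finset.Icc 1 N ∪ Finset.Ioc N T := by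
    intro t ht
    simp only [Finset.mem_union, Finset.mem_Icc, Finset.mem_Ioc] at ht ⊢
    omega
  have hdisj : Disjoint (Finset.Icc 1 N) (Finset.Ioc N T) := by
    rw [Finset.disjoint_left]
    intro t h1 h2
    simp only [Finset.mem_Icc, Finset.mem_Ioc] at h1 h2
    omega
  have h1 : ∑ t ∈ Finset.Icc 1 N, η t / t ≤ γ * (1 + Real.log N) := by
    have h2 := harmonic_le_one_add_log N
    rw [harmonic_eq_sum_Icc] at h2
    push_cast at h2
    calc ∑ t ∈ Finset.Icc 1 N, η t / t ≤ ∑ t ∈ Finset.Icc 1 N, γ * (t : ℝ)⁻¹ := by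
          refine Finset.sum_le_sum fun t ht => ?_
          rw [← div_eq_mul_inv]
          gcongr
          exact hγ t (Finset.mem_Icc.1 ht).1
      _ ≤ γ * (1 + Real.log N) := by
          rw [← Finset.mul_sum]
          gcongr
  have h2 : ∑ t ∈ Finset.Ioc N T, η t / t ≤ c * (2 / φ) := by
    calc ∑ t ∈ Finset.Ioc N T, η t / t ≤ ∑ t ∈ Finset.Ioc N T, c * (1 / ((t : ℝ) * √t)) := by
          refine Finset.sum_le_sum fun t ht => ?_
          have := hc t (by have := (Finset.mem_Ioc.1 ht).1; omega)
          calc η t / t ≤ c / √t / t := by gcongr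
            _ = _ := by rw [div_div, mul_comm (√(t : ℝ))]; ring
      _ ≤ c * (2 / √N) := by
          rw [← Finset.mul_sum]
          gcongr
          exact sum_Ioc_one_div_mul_sqrt_le hN1 T
      _ ≤ c * (2 / φ) := by gcongr
  calc φ * ∑ t ∈ Finset.Icc 1 T, η t / t
      ≤ φ * ∑ t ∈ Finset.Icc 1 N ∪ Finset.Ioc N T, η t / t := by
        gcongr φ * ?_
        refine Finset.sum_le_sum_of_subset_of_nonneg hsub fun t ht _ => hpos t ?_
        simp only [Finset.mem_union, Finset.mem_Icc, Finset.mem_Ioc] at ht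
        omega
    _ ≤ φ * (γ * (1 + (1 + 2 * Real.log φ)) + c * (2 / φ)) := by
        rw [Finset.sum_union hdisj]
        have h3 : γ * (1 + Real.log N) ≤ γ * (1 + (1 + 2 * Real.log φ)) := by gcongr
        gcongr
        linarith
    _ = _ := by
        field_simp
        ring

end Sums

/-! ### Admissibility of the stepsizes and thresholds. -/

section Admissible

variable {p G D L σs σl τs φ γ ηs lam : ℝ} {η τ : ℕ → ℝ}

/-- Comparing a sum with R = D²/η_{T+1} means multiplying it by η_{T+1}. Pairing each η_t with
η_{T+1} produces the ratio a_t/a_{T+1}, a power of t/(T+1), and by `sum_ratio_rpow_div_le` such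
powers divided by t have sums bounded uniformly in T, without logarithms. -/
lemma stepsize_mul_stepsize_le {η₁ η₂ c a₁ a₂ : ℝ} (h0 : 0 ≤ η₁) (h₁ : η₁ ≤ c / a₁)
    (h0' : 0 ≤ η₂) (h₂ : η₂ ≤ c / a₂) (ha₁ : 0 < a₁) :
    η₁ * η₂ * a₁ ^ 2 ≤ c ^ 2 * (a₁ / a₂) := by
  calc η₁ * η₂ * a₁ ^ 2 ≤ (c / a₁) * (c / a₂) * a₁ ^ 2 := by
        gcongr
        exact h0.trans h₁
    _ = c ^ 2 * (a₁ / a₂) := by field_simp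

lemma sum_gradient_le {η : ℕ → ℝ} {c : ℝ} (hη0 : ∀ t, 1 ≤ t → 0 < η t)
    (hc : ∀ t : ℕ, 1 ≤ t → η t ≤ c / √t) (T : ℕ) :
    (∑ t ∈ Finset.Icc 1 T, η t) * η (T + 1) ≤ 2 * c ^ 2 := by
  calc (∑ t ∈ Finset.Icc 1 T, η t) * η (T + 1)
      ≤ ∑ t ∈ Finset.Icc 1 T, c ^ 2 * (((t : ℝ) / (T + 1 : ℕ)) ^ (1 / 2 : ℝ) / t) := by
        rw [Finset.sum_mul]
        refine Finset.sum_le_sum fun t ht => ?_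
        have ht1 := (Finset.mem_Icc.1 ht).1
        have ht0 : (0 : ℝ) < t := by exact_mod_cast ht1
        have h := stepsize_mul_stepsize_le (hη0 t ht1).le (hc t ht1) (hη0 (T + 1) (by omega)).le
          (hc (T + 1) (by omega)) (Real.sqrt_pos.2 ht0)
        rw [Real.sq_sqrt ht0.le, ← Real.sqrt_div ht0.le, Real.sqrt_eq_rpow] at h
        rw [← mul_div_assoc, le_div_iff₀ ht0]
        exact h
    _ ≤ c ^ 2 * (1 / (1 / 2)) := by
        rw [← Finset.mul_sum]
        gcongr
        exact sum_ratio_rpow_div_le (by norm_num) (by norm_num) T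
    _ = 2 * c ^ 2 := by ring

/-- Multiplied by η_{T+1}, the left side is a product of two factors ητL: one is bounded at time t,
the other at time T + 1 because τ is nondecreasing. -/
lemma threshold_condition (hD : 0 < D) (hL : 0 < L) (hη0 : ∀ t, 1 ≤ t → 0 < η t)
    (hτ0 : ∀ t, 1 ≤ t → 0 ≤ τ t)
    (hτm : ∀ s t, 1 ≤ s → s ≤ t → τ s ≤ τ t) (hητ : ∀ t, 1 ≤ t → η t * τ t * L ≤ 2 * D)
    {T t : ℕ} (ht : t ∈ Finset.Icc 1 T) :
    η t * τ t ^ 2 * L ^ 2 ≤ 4 * (D ^ 2 / η (T + 1)) := by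
  obtain ⟨ht1, htT⟩ := Finset.mem_Icc.1 ht
  have h1 := hητ t ht1
  have h2 := hητ (T + 1) (by omega)
  have h3 := hτm t (T + 1) ht1 (by omega)
  have h4 := hη0 (T + 1) (by omega)
  have h5 := hη0 t ht1
  have h6 := hτ0 t ht1
  have h7 : η (T + 1) * τ t * L ≤ 2 * D := le_trans (by gcongr) h2
  rw [← mul_div_assoc, le_div_iff₀ h4]
  calc η t * τ t ^ 2 * L ^ 2 * η (T + 1) = (η t * τ t * L) * (η (T + 1) * τ t * L) := by ring
    _ ≤ (2 * D) * (2 * D) := by gcongr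
    _ = 4 * D ^ 2 := by ring

/-- In the presence of noise, the conditions on the parameters that make them admissible. -/
lemma isAdmissible_of_noise (hp : 1 < p) (hp2 : p ≤ 2) (hG : 0 < G) (hD : 0 < D) (hL : 1 ≤ L)
    (hs : 0 < σs) (hsl : σs ≤ σl) (hτs : 0 < τs) (hφ : 1 ≤ φ) (hφτ : φ = σl ^ p / τs ^ p)
    (hγ0 : 0 < γ) (hηs0 : 0 < ηs) (hlam0 : 0 < lam)
    (hγφ : γ * (φ * (1 + Real.log φ)) * G ≤ D) (hγL : γ * L * G ≤ D)
    (hηsG : ηs * G ≤ D) (hηsσ : ηs ^ 2 * (σl ^ p * G ^ (2 - p)) ≤ D ^ 2)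
    (hlamL : lam * L ≤ D) (hlamφ : lam ^ 2 * φ ≤ D ^ 2)
    (hlamy : lam * (σs * σl ^ (p - 1) / τs ^ p) ≤ D)
    (hη0 : ∀ t, 1 ≤ t → 0 < η t) (hηm : ∀ s t, 1 ≤ s → s ≤ t → η t ≤ η s)
    (hηγ : ∀ t, 1 ≤ t → η t ≤ γ) (hηηs : ∀ t : ℕ, 1 ≤ t → η t ≤ ηs / √t)
    (hηlam : ∀ t : ℕ, 1 ≤ t → η t ≤ lam / (τs * (t : ℝ) ^ (1 / p)))
    (hτ : ∀ t : ℕ, τ t = max (2 * G) (τs * (t : ℝ) ^ (1 / p))) (T : ℕ) :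
    IsAdmissible η τ
      (fun t => 2 * σs * σl ^ (p - 1) / τ t ^ (p - 1) + 4 * G * (σl ^ p / τ t ^ p))
      (fun t => 4 * τ t ^ (2 - p) * σs ^ p + 8 * G ^ 2 * (σl ^ p / τ t ^ p))
      (fun t => 4 * τ t ^ (2 - p) * σl ^ p + 8 * G ^ 2 * (σl ^ p / τ t ^ p))
      G L (D ^ 2 / η (T + 1)) 104 T := by
  have hp0 : 0 < p := by linarith
  have hl : 0 < σl := hs.trans_le hsl
  have hL0 : 0 < L := by linarith
  have hφ0 : 0 < φ := by linarith
  have ha0 : 0 < 1 / p := by positivity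
  have ha1 : 1 / p ≤ 1 := (div_le_one hp0).2 hp.le
  have ha2 : 1 / 2 ≤ 1 / p := by gcongr
  set u : ℕ → ℝ := fun t => τs * (t : ℝ) ^ (1 / p) with hu
  set y := σs * σl ^ (p - 1) / τs ^ p with hy
  have hy0 : 0 < y := by positivity
  have hu0 : ∀ t, 1 ≤ t → 0 < u t := fun t ht => by
    have : (0 : ℝ) < t := by exact_mod_cast ht
    simp only [hu]
    positivity
  have hup : ∀ t, 1 ≤ t → u t ^ p = τs ^ p * t := fun t ht => by
    simp only [hu]
    rw [Real.mul_rpow hτs.le (by positivity), ← Real.rpow_mul (by positivity),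
      one_div_mul_cancel hp0.ne', Real.rpow_one]
  have huratio : ∀ t, 1 ≤ t → u t / u (T + 1) = ((t : ℝ) / (T + 1 : ℕ)) ^ (1 / p) := fun t ht => by
    simp only [hu]
    rw [mul_div_mul_left _ _ hτs.ne', Real.div_rpow (by positivity) (by positivity)]
  have hτu : ∀ t, u t ≤ τ t := fun t => by rw [hτ]; exact le_max_right _ _
  have hτG : ∀ t, 2 * G ≤ τ t := fun t => by rw [hτ]; exact le_max_left _ _
  have hτ0 : ∀ t, 0 < τ t := fun t => by linarith [hτG t]
  have hφt : ∀ t, 1 ≤ t → σl ^ p / τ t ^ p ≤ φ / t := fun t ht => by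
    have ht0 : (0 : ℝ) < t := by exact_mod_cast ht
    calc σl ^ p / τ t ^ p ≤ σl ^ p / u t ^ p := by
          have := hu0 t ht
          gcongr
          exact hτu t
      _ = φ / t := by rw [hup t ht, hφτ, div_div]
  have hηT := hη0 (T + 1) (by omega)
  have hGsum : G * (φ * ∑ t ∈ Finset.Icc 1 T, η t / t) ≤ 4 * D := by
    have := sum_stepsize_div_le hγ0.le hηs0.le hφ (fun t ht => (hη0 t ht).le) hηγ hηηs T
    calc G * (φ * ∑ t ∈ Finset.Icc 1 T, η t / t)
        ≤ G * (2 * (γ * (φ * (1 + Real.log φ))) + 2 * ηs) := by gcongr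
      _ = 2 * (γ * (φ * (1 + Real.log φ)) * G) + 2 * (ηs * G) := by ring
      _ ≤ 4 * D := by linarith
  have hGsum0 : 0 ≤ G * (φ * ∑ t ∈ Finset.Icc 1 T, η t / t) := by
    have : 0 ≤ ∑ t ∈ Finset.Icc 1 T, η t / t := Finset.sum_nonneg fun t ht =>
      div_nonneg (hη0 t (Finset.mem_Icc.1 ht).1).le (by positivity)
    positivity
  have hηTG : η (T + 1) * G ≤ D := by
    have h1 := hηηs (T + 1) (by omega)
    have h2 : ηs / √((T + 1 : ℕ) : ℝ) ≤ ηs := div_le_self hηs0.le (by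
      rw [Real.one_le_sqrt]
      exact_mod_cast Nat.succ_le_succ T.zero_le)
    calc η (T + 1) * G ≤ ηs * G := by
          gcongr
          exact h1.trans h2
      _ ≤ D := hηsG
  have hηTL : η (T + 1) * L * G ≤ D := le_trans (by gcongr; exact hηγ _ (by omega)) hγL
  have hpair : ∀ t ∈ Finset.Icc 1 T, η t * η (T + 1) * (u t ^ (2 - p)) ≤
      lam ^ 2 / τs ^ p * (((t : ℝ) / (T + 1 : ℕ)) ^ (1 / p) / t) := fun t ht => by
    have ht1 := (Finset.mem_Icc.1 ht).1
    have ht0 : (0 : ℝ) < t := by exact_mod_cast ht1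
    have h := stepsize_mul_stepsize_le (hη0 t ht1).le (hηlam t ht1) hηT.le
      (hηlam (T + 1) (by omega)) (hu0 t ht1)
    calc η t * η (T + 1) * (u t ^ (2 - p)) = η t * η (T + 1) * u t ^ 2 / (τs ^ p * t) := by
          rw [Real.rpow_sub (hu0 t ht1), hup t ht1, Real.rpow_two, mul_div_assoc]
      _ ≤ lam ^ 2 * (u t / u (T + 1)) / (τs ^ p * t) := by
          gcongr
      _ = _ := by
          rw [huratio t ht1]
          field_simp
  have hpairsum : (∑ t ∈ Finset.Icc 1 T, η t * (u t ^ (2 - p))) * η (T + 1) ≤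
      2 * (lam ^ 2 / τs ^ p) := by
    calc (∑ t ∈ Finset.Icc 1 T, η t * (u t ^ (2 - p))) * η (T + 1)
        ≤ ∑ t ∈ Finset.Icc 1 T,
            lam ^ 2 / τs ^ p * (((t : ℝ) / (T + 1 : ℕ)) ^ (1 / p) / t) := by
          rw [Finset.sum_mul]
          refine Finset.sum_le_sum fun t ht => ?_
          refine le_trans (le_of_eq ?_) (hpair t ht)
          ring
      _ ≤ lam ^ 2 / τs ^ p * (1 / (1 / p)) := by
          rw [← Finset.mul_sum]
          gcongr
          exact sum_ratio_rpow_div_le ha0 ha1 T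
      _ ≤ lam ^ 2 / τs ^ p * 2 := by
          gcongr
          rwa [one_div_one_div]
      _ = _ := by ring
  have hbias : ∀ t ∈ Finset.Icc 1 T,
      √(η t) * (2 * σs * σl ^ (p - 1) / τ t ^ (p - 1) + 4 * G * (σl ^ p / τ t ^ p)) * √(η (T + 1)) ≤
      2 * (lam * y) * (((t : ℝ) / (T + 1 : ℕ)) ^ (1 / p / 2) / t) + 4 * G * φ * (η t / t) := by
    intro t ht
    obtain ⟨ht1, htT⟩ := Finset.mem_Icc.1 ht
    have ht0 : (0 : ℝ) < t := by exact_mod_cast ht1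
    have hη1 := hη0 t ht1
    have hut := hu0 t ht1
    have huT := hu0 (T + 1) (by omega)
    -- Enough for the part of the bias proportional to G, which then becomes φΣη_t/t. The part with
    -- σs σl^(p-1) needs the sharper pairing `h2`.
    have h1 : √(η t) * √(η (T + 1)) ≤ η t := by
      calc √(η t) * √(η (T + 1)) ≤ √(η t) * √(η t) := by
            gcongr
            exact hηm t (T + 1) ht1 (by omega)
        _ = η t := Real.mul_self_sqrt hη1.le
    have h2 : √(η t) * √(η (T + 1)) * u t ≤ lam * ((t : ℝ) / (T + 1 : ℕ)) ^ (1 / p / 2) := by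
      refine (sq_le_sq₀ (by positivity) (by positivity)).1 ?_
      have h := stepsize_mul_stepsize_le hη1.le (hηlam t ht1) hηT.le
        (hηlam (T + 1) (by omega)) hut
      calc (√(η t) * √(η (T + 1)) * u t) ^ 2 = η t * η (T + 1) * u t ^ 2 := by
            rw [mul_pow, mul_pow, Real.sq_sqrt hη1.le, Real.sq_sqrt hηT.le]
        _ ≤ lam ^ 2 * (u t / u (T + 1)) := h
        _ = (lam * ((t : ℝ) / (T + 1 : ℕ)) ^ (1 / p / 2)) ^ 2 := by
            rw [huratio t ht1, mul_pow, ← Real.rpow_natCast (_ ^ _) 2,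
              ← Real.rpow_mul (by positivity)]
            congr 2
            push_cast
            ring
    have h3 : 1 / τ t ^ (p - 1) ≤ u t / (τs ^ p * t) := by
      calc 1 / τ t ^ (p - 1) ≤ 1 / u t ^ (p - 1) := by
            gcongr
            exact hτu t
        _ = u t / (τs ^ p * t) := by
            rw [Real.rpow_sub_one hut.ne', hup t ht1, one_div_div]
    have h4 := hφt t ht1
    have h5 : 0 ≤ σl ^ p / τ t ^ p := by
      have := hτ0 t
      positivity
    calc √(η t) * (2 * σs * σl ^ (p - 1) / τ t ^ (p - 1) + 4 * G * (σl ^ p / τ t ^ p))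
          * √(η (T + 1))
        = 2 * (σs * σl ^ (p - 1)) * (√(η t) * √(η (T + 1)) * (1 / τ t ^ (p - 1)))
          + 4 * G * ((√(η t) * √(η (T + 1))) * (σl ^ p / τ t ^ p)) := by ring
      _ ≤ 2 * (σs * σl ^ (p - 1)) * (√(η t) * √(η (T + 1)) * (u t / (τs ^ p * t)))
          + 4 * G * (η t * (φ / t)) := by gcongr
      _ = 2 * y / t * (√(η t) * √(η (T + 1)) * u t) + 4 * G * φ * (η t / t) := by
          rw [hy]
          field_simp
      _ ≤ 2 * y / t * (lam * ((t : ℝ) / (T + 1 : ℕ)) ^ (1 / p / 2)) + 4 * G * φ * (η t / t) := by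
          gcongr
      _ = _ := by ring
  have hR : ∀ S A : ℝ, S * η (T + 1) ≤ A * D ^ 2 → S ≤ A * (D ^ 2 / η (T + 1)) := fun S A h => by
    rwa [← mul_div_assoc, le_div_iff₀ hηT]
  refine ⟨fun t ht => ?_, ?_, ?_, ?_, ?_⟩
  · refine threshold_condition hD hL0 hη0 (fun t _ => (hτ0 t).le) (fun s t hs1 hst => ?_)
      (fun t ht => ?_) ht
    · rw [hτ, hτ]
      gcongr
    · rw [hτ]
      rcases max_cases (2 * G) (τs * (t : ℝ) ^ (1 / p)) with ⟨h, -⟩ | ⟨h, -⟩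
      · rw [h]
        calc η t * (2 * G) * L ≤ γ * (2 * G) * L := by gcongr; exact hηγ t ht
          _ = 2 * (γ * L * G) := by ring
          _ ≤ 2 * D := by linarith
      · rw [h]
        have h1 := hηlam t ht
        rw [le_div_iff₀ (hu0 t ht)] at h1
        calc η t * (τs * (t : ℝ) ^ (1 / p)) * L ≤ lam * L := by gcongr
          _ ≤ 2 * D := by linarith
  · rw [Real.sqrt_div (by positivity), Real.sqrt_sq hD.le, ← mul_div_assoc,
      le_div_iff₀ (Real.sqrt_pos.2 hηT), Finset.sum_mul]
    calc _ ≤ ∑ t ∈ Finset.Icc 1 T, (2 * (lam * y) * (((t : ℝ) / (T + 1 : ℕ)) ^ (1 / p / 2) / t)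
          + 4 * G * φ * (η t / t)) := Finset.sum_le_sum hbias
      _ = 2 * (lam * y) * (∑ t ∈ Finset.Icc 1 T, ((t : ℝ) / (T + 1 : ℕ)) ^ (1 / p / 2) / t)
          + 4 * (G * (φ * ∑ t ∈ Finset.Icc 1 T, η t / t)) := by
          rw [Finset.sum_add_distrib, ← Finset.mul_sum, ← Finset.mul_sum]
          ring
      _ ≤ 2 * D * (1 / (1 / p / 2)) + 4 * (4 * D) := by
          gcongr
          exact sum_ratio_rpow_div_le (by positivity) (by linarith) T
      _ ≤ 2 * D * 4 + 4 * (4 * D) := by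
          gcongr
          rw [one_div_div, div_le_iff₀ ha0]
          linarith
      _ ≤ 104 * D := by linarith
  · refine hR _ _ ?_
    have hV : ∀ t ∈ Finset.Icc 1 T,
        η t * (4 * τ t ^ (2 - p) * σs ^ p + 8 * G ^ 2 * (σl ^ p / τ t ^ p)) ≤
        24 * G ^ 2 * φ * (η t / t) + 4 * σs ^ p * (η t * u t ^ (2 - p)) := by
      intro t ht
      have ht1 := (Finset.mem_Icc.1 ht).1
      have ht0 : (0 : ℝ) < t := by exact_mod_cast ht1
      have hη1 := hη0 t ht1
      have hut := hu0 t ht1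
      -- Where the threshold equals 2G, the left side is 4G²σs^p/τ^p, which is of the same kind as
      -- the second variance term because σs ≤ σl.
      have h1 : τ t ^ (2 - p) * σs ^ p ≤ 4 * G ^ 2 * (φ / t) + σs ^ p * u t ^ (2 - p) := by
        rcases le_total (2 * G) (u t) with h | h
        · have : τ t = u t := by rw [hτ]; exact max_eq_right h
          rw [this]
          have : 0 ≤ 4 * G ^ 2 * (φ / t) := by positivity
          linarith
        · have hτt : τ t = 2 * G := by rw [hτ]; exact max_eq_left h
          have h2 : τ t ^ (2 - p) * σs ^ p ≤ 4 * G ^ 2 * (σl ^ p / τ t ^ p) := by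
            rw [Real.rpow_sub (hτ0 t), Real.rpow_two, div_mul_eq_mul_div, ← mul_div_assoc]
            have h3 : τ t ^ 2 * σs ^ p ≤ 4 * G ^ 2 * σl ^ p := by
              rw [hτt, show (2 * G) ^ 2 = 4 * G ^ 2 by ring]
              gcongr
            have := hτ0 t
            gcongr
          have h3 := mul_le_mul_of_nonneg_left (hφt t ht1) (by positivity : 0 ≤ 4 * G ^ 2)
          have : 0 ≤ σs ^ p * u t ^ (2 - p) := by positivity
          linarith
      have h3 := mul_le_mul_of_nonneg_left (hφt t ht1) (by positivity : 0 ≤ 8 * G ^ 2)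
      calc η t * (4 * τ t ^ (2 - p) * σs ^ p + 8 * G ^ 2 * (σl ^ p / τ t ^ p))
          ≤ η t * (4 * (4 * G ^ 2 * (φ / t) + σs ^ p * u t ^ (2 - p)) + 8 * G ^ 2 * (φ / t)) := by
            gcongr η t * ?_
            linarith
        _ = _ := by ring
    -- With this, λ²Lσs^p/τ⋆^p splits into the factors λL and λy, each at most D.
    have hσ : σs ^ p / τs ^ p ≤ y := by
      rw [hy]
      gcongr
      calc σs ^ p = σs * σs ^ (p - 1) := by rw [Real.rpow_sub_one hs.ne']; field_simp
        _ ≤ σs * σl ^ (p - 1) := by gcongr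
    calc (L * ∑ t ∈ Finset.Icc 1 T,
          η t * (4 * τ t ^ (2 - p) * σs ^ p + 8 * G ^ 2 * (σl ^ p / τ t ^ p))) * η (T + 1)
        ≤ (L * ∑ t ∈ Finset.Icc 1 T, (24 * G ^ 2 * φ * (η t / t)
          + 4 * σs ^ p * (η t * u t ^ (2 - p)))) * η (T + 1) := by
          gcongr ((L * ?_) * η (T + 1))
          exact Finset.sum_le_sum hV
      _ = 24 * (η (T + 1) * L * G) * (G * (φ * ∑ t ∈ Finset.Icc 1 T, η t / t))
          + 4 * L * σs ^ p * ((∑ t ∈ Finset.Icc 1 T, η t * u t ^ (2 - p)) * η (T + 1)) := by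
          rw [Finset.sum_add_distrib, ← Finset.mul_sum, ← Finset.mul_sum]
          ring
      _ ≤ 24 * D * (4 * D) + 4 * L * σs ^ p * (2 * (lam ^ 2 / τs ^ p)) := by gcongr
      _ = 96 * D ^ 2 + 8 * ((lam * L) * (lam * (σs ^ p / τs ^ p))) := by ring
      _ ≤ 96 * D ^ 2 + 8 * (D * (lam * y)) := by gcongr
      _ ≤ 96 * D ^ 2 + 8 * (D * D) := by gcongr
      -- The largest of the five constants, hence the common value 104.
      _ = 104 * D ^ 2 := by ring
  · refine hR _ _ ?_
    have hW : ∀ t ∈ Finset.Icc 1 T,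
        η t * (4 * τ t ^ (2 - p) * σl ^ p + 8 * G ^ 2 * (σl ^ p / τ t ^ p)) ≤
        8 * (σl ^ p * G ^ (2 - p)) * η t + 4 * σl ^ p * (η t * u t ^ (2 - p))
          + 8 * G ^ 2 * φ * (η t / t) := by
      intro t ht
      have ht1 := (Finset.mem_Icc.1 ht).1
      have ht0 : (0 : ℝ) < t := by exact_mod_cast ht1
      have hη1 := hη0 t ht1
      have hut := hu0 t ht1
      have h1 : τ t ^ (2 - p) ≤ 2 * G ^ (2 - p) + u t ^ (2 - p) := by
        rcases le_total (2 * G) (u t) with h | h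
        · have : τ t = u t := by rw [hτ]; exact max_eq_right h
          rw [this]
          have : 0 ≤ 2 * G ^ (2 - p) := by positivity
          linarith
        · have hτt : τ t = 2 * G := by rw [hτ]; exact max_eq_left h
          have h2 : (2 : ℝ) ^ (2 - p) ≤ 2 := by
            simpa using Real.rpow_le_rpow_of_exponent_le (x := 2) (by norm_num)
              (by linarith : 2 - p ≤ 1)
          rw [hτt, Real.mul_rpow (by norm_num) hG.le]
          have h3 : (2 : ℝ) ^ (2 - p) * G ^ (2 - p) ≤ 2 * G ^ (2 - p) := by gcongr
          have : 0 ≤ u t ^ (2 - p) := by positivity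
          linarith
      have h3 := hφt t ht1
      calc η t * (4 * τ t ^ (2 - p) * σl ^ p + 8 * G ^ 2 * (σl ^ p / τ t ^ p))
          ≤ η t * (4 * (2 * G ^ (2 - p) + u t ^ (2 - p)) * σl ^ p + 8 * G ^ 2 * (φ / t)) := by
            gcongr
        _ = _ := by ring
    have hsum := sum_gradient_le hη0 hηηs T
    calc (∑ t ∈ Finset.Icc 1 T,
          η t * (4 * τ t ^ (2 - p) * σl ^ p + 8 * G ^ 2 * (σl ^ p / τ t ^ p))) * η (T + 1)
        ≤ (∑ t ∈ Finset.Icc 1 T, (8 * (σl ^ p * G ^ (2 - p)) * η t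
          + 4 * σl ^ p * (η t * u t ^ (2 - p)) + 8 * G ^ 2 * φ * (η t / t))) * η (T + 1) := by
          gcongr ?_ * η (T + 1)
          exact Finset.sum_le_sum hW
      _ = 8 * (σl ^ p * G ^ (2 - p)) * ((∑ t ∈ Finset.Icc 1 T, η t) * η (T + 1))
          + 4 * σl ^ p * ((∑ t ∈ Finset.Icc 1 T, η t * u t ^ (2 - p)) * η (T + 1))
          + 8 * (η (T + 1) * G) * (G * (φ * ∑ t ∈ Finset.Icc 1 T, η t / t)) := by
          rw [Finset.sum_add_distrib, Finset.sum_add_distrib, ← Finset.mul_sum, ← Finset.mul_sum,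
            ← Finset.mul_sum]
          ring
      _ ≤ 8 * (σl ^ p * G ^ (2 - p)) * (2 * ηs ^ 2) + 4 * σl ^ p * (2 * (lam ^ 2 / τs ^ p))
          + 8 * D * (4 * D) := by gcongr
      _ = 16 * (ηs ^ 2 * (σl ^ p * G ^ (2 - p))) + 8 * (lam ^ 2 * φ) + 32 * D ^ 2 := by
          rw [hφτ]
          ring
      _ ≤ 104 * D ^ 2 := by nlinarith
  · refine hR _ _ ?_
    have hsum := sum_gradient_le hη0 hηηs T
    calc (∑ t ∈ Finset.Icc 1 T, 4 * η t * G ^ 2) * η (T + 1)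
        = 4 * G ^ 2 * ((∑ t ∈ Finset.Icc 1 T, η t) * η (T + 1)) := by
          rw [← Finset.sum_mul, ← Finset.mul_sum]
          ring
      _ ≤ 4 * G ^ 2 * (2 * ηs ^ 2) := by gcongr
      _ = 8 * (ηs * G) ^ 2 := by ring
      _ ≤ 8 * D ^ 2 := by gcongr
      _ ≤ 104 * D ^ 2 := by nlinarith

/-- Without noise, large stepsizes are admissible. -/
lemma isAdmissible_of_noiseless (hG : 0 < G) (hD : 0 < D) (hL : 1 ≤ L)
    (hηs0 : 0 < ηs) (hγL : γ * L * G ≤ D) (hηsG : ηs * G ≤ D)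
    (hη0 : ∀ t, 1 ≤ t → 0 < η t) (hηγ : ∀ t, 1 ≤ t → η t ≤ γ)
    (hηηs : ∀ t : ℕ, 1 ≤ t → η t ≤ ηs / √t) (hτ : ∀ t, τ t = 2 * G) (T : ℕ) :
    IsAdmissible η τ 0 0 0 G L (D ^ 2 / η (T + 1)) 104 T := by
  have hηT := hη0 (T + 1) (by omega)
  have hL0 : 0 < L := by linarith
  refine ⟨fun t ht => ?_, ?_, ?_, ?_, ?_⟩
  · refine threshold_condition hD hL0 hη0 (fun t _ => by rw [hτ]; positivity)
      (fun s t _ _ => by rw [hτ, hτ]) (fun t ht => ?_) ht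
    rw [hτ]
    calc η t * (2 * G) * L ≤ γ * (2 * G) * L := by gcongr; exact hηγ t ht
      _ = 2 * (γ * L * G) := by ring
      _ ≤ 2 * D := by linarith
  · simp only [Pi.zero_apply, mul_zero, Finset.sum_const_zero]
    positivity
  · simp only [Pi.zero_apply, mul_zero, Finset.sum_const_zero]
    positivity
  · simp only [Pi.zero_apply, mul_zero, Finset.sum_const_zero]
    positivity
  · rw [← mul_div_assoc, le_div_iff₀ hηT]
    have hsum := sum_gradient_le hη0 hηηs T
    calc (∑ t ∈ Finset.Icc 1 T, 4 * η t * G ^ 2) * η (T + 1)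
        = 4 * G ^ 2 * ((∑ t ∈ Finset.Icc 1 T, η t) * η (T + 1)) := by
          rw [← Finset.sum_mul, ← Finset.mul_sum]
          ring
      _ ≤ 4 * G ^ 2 * (2 * ηs ^ 2) := by gcongr
      _ = 8 * (ηs * G) ^ 2 := by ring
      _ ≤ 8 * D ^ 2 := by gcongr
      _ ≤ 104 * D ^ 2 := by nlinarith

end Admissible

/-! ### Properties of the parameters and comparison with the rate. -/

section Parameters

variable {p G D σs σl δ : ℝ}

lemma one_le_log_three_div (hδ : 0 < δ) (hδ1 : δ ≤ 1) : 1 ≤ Real.log (3 / δ) := by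
  rw [Real.le_log_iff_exp_le (by positivity), le_div_iff₀ hδ]
  nlinarith [Real.exp_one_lt_d9, Real.exp_pos 1]

lemma gammaStar_mul_le (hG : 0 < G) (hD : 0 < D)
    (hφ : 0 ≤ phiStar p σs σl δ * psiStar p σs σl δ) (hL : 0 < Real.log (3 / δ)) :
    0 < gammaStar p σs σl G D δ ∧
      gammaStar p σs σl G D δ * (phiStar p σs σl δ * psiStar p σs σl δ) * G ≤ D ∧
      gammaStar p σs σl G D δ * Real.log (3 / δ) * G ≤ D := by
  have h0 : 0 < gammaStar p σs σl G D δ := by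
    unfold gammaStar
    positivity
  have h1 : gammaStar p σs σl G D δ *
      (phiStar p σs σl δ * psiStar p σs σl δ + Real.log (3 / δ)) * G = D := by
    unfold gammaStar
    field_simp
  refine ⟨h0, ?_, ?_⟩
  · have : 0 < gammaStar p σs σl G D δ * Real.log (3 / δ) * G := by positivity
    linarith
  · have : 0 ≤ gammaStar p σs σl G D δ * (phiStar p σs σl δ * psiStar p σs σl δ) * G := by
      positivity
    linarith

lemma etaStar_pos (hG : 0 < G) (hD : 0 < D) (hl : 0 ≤ σl) : 0 < etaStar p σl G D := by
  unfold etaStar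
  positivity

lemma etaStar_mul_le (hG : 0 < G) (hD : 0 < D) (hl : 0 ≤ σl) : etaStar p σl G D * G ≤ D := by
  have h1 : 1 ≤ √(σl ^ p / G ^ p + 1) := by
    rw [Real.one_le_sqrt]
    have : 0 ≤ σl ^ p / G ^ p := by positivity
    linarith
  calc etaStar p σl G D * G = D / √(σl ^ p / G ^ p + 1) := by
        unfold etaStar
        field_simp
    _ ≤ D := div_le_self hD.le h1

lemma etaStar_sq_mul_le (hG : 0 < G) (hl : 0 ≤ σl) :
    etaStar p σl G D ^ 2 * (σl ^ p * G ^ (2 - p)) ≤ D ^ 2 := by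
  have h0 : 0 ≤ σl ^ p / G ^ p := by positivity
  have h1 : √(σl ^ p / G ^ p + 1) ^ 2 = σl ^ p / G ^ p + 1 := Real.sq_sqrt (by positivity)
  calc etaStar p σl G D ^ 2 * (σl ^ p * G ^ (2 - p))
      = D ^ 2 * ((σl ^ p / G ^ p) / (σl ^ p / G ^ p + 1)) := by
        unfold etaStar
        rw [div_pow, h1, div_pow, Real.rpow_sub hG, Real.rpow_two]
        field_simp
    _ ≤ D ^ 2 * 1 := by
        gcongr
        exact (div_le_one (by positivity)).2 (by linarith)
    _ = D ^ 2 := mul_one _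

/-- The two candidates for `τ⋆ ^ p`, and what is needed about their minimum. -/
lemma tauStar_rpow_cases (hp : 1 < p) (hs : 0 < σs) (hl : 0 < σl)
    (hL : 0 < Real.log (3 / δ)) :
    0 < tauStar p σs σl δ ∧ phiStar p σs σl δ = σl ^ p / tauStar p σs σl δ ^ p ∧
      tauStar p σs σl δ ^ p ≤ σs * σl ^ (p - 1) / Real.log (3 / δ) ∧
      (p < 2 → tauStar p σs σl δ ^ p ≤ σs ^ 2 / σl ^ (2 - p)) ∧
      (tauStar p σs σl δ ^ p = σs * σl ^ (p - 1) / Real.log (3 / δ) ∨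
        p < 2 ∧ tauStar p σs σl δ ^ p = σs ^ 2 / σl ^ (2 - p)) := by
  have hp0 : p ≠ 0 := by linarith
  set L := Real.log (3 / δ) with hLdef
  set m₁ := σs * σl ^ (p - 1) / L with hm₁
  set m₂ := σs ^ 2 / σl ^ (2 - p) with hm₂
  have h₁ : 0 < m₁ := by positivity
  have h₂ : 0 < m₂ := by positivity
  have hφ₁ : √(dEff σs σl) * L = σl ^ p / m₁ := by
    rw [dEff, ← div_pow, Real.sqrt_sq (by positivity), hm₁, Real.rpow_sub_one hl.ne']
    field_simp
  have hφ₂ : dEff σs σl = σl ^ p / m₂ := by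
    rw [dEff, hm₂, Real.rpow_sub hl, Real.rpow_two]
    field_simp
  have hpow : ∀ m : ℝ, 0 < m → (m ^ (1 / p)) ^ p = m := fun m hm => by
    rw [← Real.rpow_mul hm.le, one_div_mul_cancel hp0, Real.rpow_one]
  unfold phiStar tauStar
  rw [← hLdef, hφ₁]
  by_cases h : p < 2
  · simp only [h, if_true, mul_one, forall_true_left, true_and]
    rw [hφ₂, hpow _ (lt_min h₁ h₂)]
    refine ⟨by positivity, ?_, min_le_left _ _, min_le_right _ _, min_choice _ _⟩
    rcases le_total m₁ m₂ with hle | hle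
    · rw [min_eq_left hle]
      exact max_eq_left (by gcongr)
    · rw [min_eq_right hle]
      exact max_eq_right (by gcongr)
  · simp only [h, if_false, mul_zero, false_and, or_false, false_implies, true_and]
    rw [hpow _ h₁]
    exact ⟨by positivity, max_eq_left (by positivity), le_rfl, rfl⟩

lemma one_le_phiStar (hs : 0 < σs) (hsl : σs ≤ σl) (hL : 1 ≤ Real.log (3 / δ)) :
    1 ≤ phiStar p σs σl δ := by
  refine le_trans ?_ (le_max_left _ _)
  have h1 : 1 ≤ σl / σs := (one_le_div hs).2 hsl
  rw [dEff, ← div_pow, Real.sqrt_sq (by linarith)]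
  exact one_le_mul_of_one_le_of_one_le h1 hL

lemma lambdaStar_eq (hl : 0 < σl) (hτ : 0 < tauStar p σs σl δ) :
    lambdaStar p σs σl D δ = D / √(Real.log (3 / δ) ^ 2 + σl ^ p / tauStar p σs σl δ ^ p
      + (σs * σl ^ (p - 1) / tauStar p σs σl δ ^ p) ^ 2) := by
  have h1 : σl ^ (2 * p - 2) = (σl ^ (p - 1)) ^ 2 := by
    rw [← Real.rpow_natCast, ← Real.rpow_mul hl.le]
    push_cast
    ring_nf
  have h2 : tauStar p σs σl δ ^ (2 * p) = (tauStar p σs σl δ ^ p) ^ 2 := by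
    rw [← Real.rpow_natCast, ← Real.rpow_mul hτ.le]
    push_cast
    ring_nf
  unfold lambdaStar
  rw [h1, h2, div_pow, mul_pow]

lemma lambdaStar_mul_le (hD : 0 < D) (hs : 0 < σs) (hl : 0 < σl) (hτ : 0 < tauStar p σs σl δ)
    (hL : 0 < Real.log (3 / δ)) :
    0 < lambdaStar p σs σl D δ ∧ lambdaStar p σs σl D δ * Real.log (3 / δ) ≤ D ∧
      lambdaStar p σs σl D δ ^ 2 * (σl ^ p / tauStar p σs σl δ ^ p) ≤ D ^ 2 ∧
      lambdaStar p σs σl D δ * (σs * σl ^ (p - 1) / tauStar p σs σl δ ^ p) ≤ D := by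
  rw [lambdaStar_eq hl hτ]
  set L := Real.log (3 / δ)
  set φ := σl ^ p / tauStar p σs σl δ ^ p
  set y := σs * σl ^ (p - 1) / tauStar p σs σl δ ^ p
  have hφ : 0 < φ := by positivity
  have hy : 0 < y := by positivity
  have hS : 0 < L ^ 2 + φ + y ^ 2 := by positivity
  have hle : ∀ z, z ^ 2 ≤ L ^ 2 + φ + y ^ 2 → D / √(L ^ 2 + φ + y ^ 2) * z ≤ D := fun z hz => by
    rw [div_mul_eq_mul_div, div_le_iff₀ (Real.sqrt_pos.2 hS)]
    gcongr
    exact Real.le_sqrt_of_sq_le hz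
  refine ⟨by positivity, hle _ (by nlinarith), ?_, hle _ (by nlinarith)⟩
  rw [div_pow, Real.sq_sqrt hS.le, div_mul_eq_mul_div, div_le_iff₀ hS]
  gcongr
  nlinarith

/-- The left side is √(τ²(L² + φ + y²)) with φ = σl^p/τ^p and y = σs σl^(p-1)/τ^p, and each of τL,
τ√φ, τy is at most Q₁ + Q₂; the constant 2 covers √3. If the first candidate for τ^p is attained,
then y = L and φ = (σl/σs)L. If the second is attained, then y = σl/σs and φ = y². The candidates
themselves turn τL and τσl/σs into Q₂ and Q₁. -/
lemma tauStar_mul_le (hp : 1 < p) (hp2 : p ≤ 2) (hD : 0 < D) (hs : 0 < σs) (hl : 0 < σl)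
    (hL : 0 < Real.log (3 / δ)) :
    tauStar p σs σl δ * (D / lambdaStar p σs σl D δ) ≤
      2 * (σs ^ (2 / p - 1) * σl ^ (2 - 2 / p)
        + σs ^ (1 / p) * σl ^ (1 - 1 / p) * Real.log (3 / δ) ^ (1 - 1 / p)) := by
  obtain ⟨hτ, -, hτ₁, hτ₂, hτ₃⟩ := tauStar_rpow_cases (δ := δ) hp hs hl hL
  have hp0 : 0 < p := by linarith
  rw [lambdaStar_eq hl hτ]
  set L := Real.log (3 / δ)
  set τ := tauStar p σs σl δ
  set Q₁ := σs ^ (2 / p - 1) * σl ^ (2 - 2 / p) with hQ₁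
  set Q₂ := σs ^ (1 / p) * σl ^ (1 - 1 / p) * L ^ (1 - 1 / p) with hQ₂
  have hQ₁0 : 0 < Q₁ := by positivity
  have hQ₂0 : 0 < Q₂ := by positivity
  have e₂ : (σs * σl ^ (p - 1) / L) ^ (1 / p) * L = Q₂ := by
    rw [Real.div_rpow (by positivity) hL.le, Real.mul_rpow hs.le (by positivity),
      ← Real.rpow_mul hl.le, show (p - 1) * (1 / p) = 1 - 1 / p by field_simp, hQ₂,
      Real.rpow_sub hL 1, Real.rpow_one]
    ring
  have e₁ : (σs ^ 2 / σl ^ (2 - p)) ^ (1 / p) * (σl / σs) = Q₁ := by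
    rw [← Real.rpow_two, Real.div_rpow (by positivity) (by positivity), ← Real.rpow_mul hs.le,
      ← Real.rpow_mul hl.le, show (2 - p) * (1 / p) = 2 / p - 1 by field_simp,
      show 2 * (1 / p) = 2 / p by ring, hQ₁, Real.rpow_sub hs, Real.rpow_sub hl, Real.rpow_sub hl,
      Real.rpow_one, Real.rpow_one, Real.rpow_two]
    field_simp
  have hroot : τ = (τ ^ p) ^ (1 / p) := by
    rw [← Real.rpow_mul hτ.le, mul_one_div_cancel hp0.ne', Real.rpow_one]
  have h₁ : τ * L ≤ Q₂ := by
    rw [← e₂]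
    gcongr
    rw [hroot]
    gcongr
  have h₁' : p < 2 → τ * (σl / σs) ≤ Q₁ := fun h => by
    rw [← e₁]
    gcongr
    rw [hroot]
    have := hτ₂ h
    gcongr
  have h₂ : τ * (σs * σl ^ (p - 1) / τ ^ p) ≤ Q₁ + Q₂ := by
    rcases hτ₃ with h | ⟨hlt, h⟩
    · have : σs * σl ^ (p - 1) / τ ^ p = L := by
        rw [h]
        field_simp
      rw [this]
      linarith
    · have : σs * σl ^ (p - 1) / τ ^ p = σl / σs := by
        rw [h, Real.rpow_sub_one hl.ne', Real.rpow_sub hl, Real.rpow_two]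
        field_simp
      rw [this]
      linarith [h₁' hlt]
  have h₃ : τ ^ 2 * (σl ^ p / τ ^ p) ≤ (Q₁ + Q₂) ^ 2 := by
    rcases hτ₃ with h | ⟨hlt, h⟩
    · have e : σl ^ p / τ ^ p = σl / σs * L := by
        rw [h, Real.rpow_sub_one hl.ne']
        field_simp
      -- For p = 2 the second candidate is absent and τσl/σs is not controlled by it, but τ²φ = σl²
      -- = Q₁² holds exactly.
      rcases hp2.lt_or_eq with hlt | rfl
      · calc τ ^ 2 * (σl ^ p / τ ^ p) = (τ * (σl / σs)) * (τ * L) := by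
              rw [e]
              ring
          _ ≤ Q₁ * Q₂ := by
              gcongr
              exact h₁' hlt
          _ ≤ (Q₁ + Q₂) ^ 2 := by nlinarith
      · have hQ : Q₁ = σl := by
          rw [hQ₁]
          norm_num
        have h2 : τ ^ 2 * (σl ^ (2 : ℝ) / τ ^ (2 : ℝ)) = Q₁ ^ 2 := by
          rw [hQ, Real.rpow_two, Real.rpow_two]
          field_simp
        rw [h2]
        gcongr
        linarith
    · have e : σl ^ p / τ ^ p = (σl / σs) ^ 2 := by
        rw [h, Real.rpow_sub hl, Real.rpow_two]
        field_simp
      rw [e, ← mul_pow]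
      have := h₁' hlt
      gcongr
      linarith
  set φ := σl ^ p / τ ^ p
  set y := σs * σl ^ (p - 1) / τ ^ p
  have hy : 0 < y := by positivity
  have hφ : 0 < φ := by positivity
  have hS : 0 < L ^ 2 + φ + y ^ 2 := by positivity
  calc τ * (D / (D / √(L ^ 2 + φ + y ^ 2))) = √(τ ^ 2 * (L ^ 2 + φ + y ^ 2)) := by
        rw [Real.sqrt_mul (by positivity), Real.sqrt_sq hτ.le]
        field_simp
    _ ≤ 2 * (Q₁ + Q₂) := by
        rw [Real.sqrt_le_left (by positivity)]
        have h4 : (τ * L) ^ 2 ≤ (Q₁ + Q₂) ^ 2 := by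
          gcongr
          linarith
        have h5 : (τ * y) ^ 2 ≤ (Q₁ + Q₂) ^ 2 := by gcongr
        nlinarith

lemma etaStar_rate_le (hG : 0 < G) (hD : 0 < D) (hl : 0 ≤ σl) :
    D / etaStar p σl G D ≤ σl ^ (p / 2) * G ^ (1 - p / 2) + G := by
  have hq : 0 ≤ σl ^ p / G ^ p := by positivity
  have h1 : √(σl ^ p / G ^ p + 1) ≤ σl ^ (p / 2) / G ^ (p / 2) + 1 := by
    have h2 : σl ^ p / G ^ p = (σl ^ (p / 2) / G ^ (p / 2)) ^ 2 := by
      rw [div_pow, ← Real.rpow_natCast, ← Real.rpow_natCast, ← Real.rpow_mul hl,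
        ← Real.rpow_mul hG.le]
      push_cast
      ring_nf
    have h3 : 0 ≤ σl ^ (p / 2) / G ^ (p / 2) := by positivity
    rw [Real.sqrt_le_left (by positivity), h2]
    nlinarith
  calc D / etaStar p σl G D = G * √(σl ^ p / G ^ p + 1) := by
        unfold etaStar
        field_simp
    _ ≤ G * (σl ^ (p / 2) / G ^ (p / 2) + 1) := by gcongr
    _ = σl ^ (p / 2) * G ^ (1 - p / 2) + G := by
        rw [Real.rpow_sub hG, Real.rpow_one]
        ring

lemma sqrt_succ_div_le {T : ℕ} (hT : 1 ≤ T) : √((T + 1 : ℕ) : ℝ) / T ≤ 2 / √T := by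
  have hT0 : (1 : ℝ) ≤ T := by exact_mod_cast hT
  have h1 : √((T + 1 : ℕ) : ℝ) ≤ 2 * √T := by
    rw [Real.sqrt_le_left (by positivity), mul_pow, Real.sq_sqrt (by positivity)]
    push_cast
    linarith
  rw [div_le_div_iff₀ (by positivity) (by positivity)]
  calc √((T + 1 : ℕ) : ℝ) * √T ≤ 2 * √T * √T := by gcongr
    _ = 2 * T := by rw [mul_assoc, Real.mul_self_sqrt (by positivity)]

lemma rpow_succ_div_le {a : ℝ} (ha0 : 0 ≤ a) (ha1 : a ≤ 1) {T : ℕ} (hT : 1 ≤ T) :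
    ((T + 1 : ℕ) : ℝ) ^ a / T ≤ 2 / (T : ℝ) ^ (1 - a) := by
  have hT0 : (1 : ℝ) ≤ T := by exact_mod_cast hT
  have hT1 : (0 : ℝ) < T := by linarith
  have h1 : ((T + 1 : ℕ) : ℝ) ^ a ≤ 2 * (T : ℝ) ^ a := by
    calc ((T + 1 : ℕ) : ℝ) ^ a ≤ (2 * T : ℝ) ^ a := by
          gcongr
          push_cast
          linarith
      _ = 2 ^ a * (T : ℝ) ^ a := Real.mul_rpow (by norm_num) hT1.le
      _ ≤ 2 * (T : ℝ) ^ a := by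
          gcongr
          simpa using Real.rpow_le_rpow_of_exponent_le (x := 2) (by norm_num) ha1
  calc ((T + 1 : ℕ) : ℝ) ^ a / T ≤ 2 * (T : ℝ) ^ a / T := by gcongr
    _ = 2 / (T : ℝ) ^ (1 - a) := by
      rw [Real.rpow_sub hT1, Real.rpow_one]
      field_simp

lemma inv_min_le {a b : ℝ} (ha : 0 < a) (hb : 0 < b) : 1 / min a b ≤ 1 / a + 1 / b := by
  have : 0 < 1 / a := by positivity
  have : 0 < 1 / b := by positivity
  rcases min_choice a b with h | h <;> rw [h] <;> linarith

lemma gammaStar_rate (hG : 0 < G) (hD : 0 < D)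
    (h : 0 < phiStar p σs σl δ * psiStar p σs σl δ + Real.log (3 / δ)) :
    D ^ 2 * (1 / gammaStar p σs σl G D δ) =
      (phiStar p σs σl δ * psiStar p σs σl δ + Real.log (3 / δ)) * G * D := by
  unfold gammaStar
  field_simp

lemma etaStar_stepsize_rate_le (hG : 0 < G) (hD : 0 < D) (hl : 0 ≤ σl) {T : ℕ} (hT : 1 ≤ T) :
    D ^ 2 * (1 / (etaStar p σl G D / √((T + 1 : ℕ) : ℝ))) / T ≤
      2 * ((σl ^ (p / 2) * G ^ (1 - p / 2) + G) * D / √T) := by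
  have h1 := etaStar_rate_le (p := p) hG hD hl
  have h2 := sqrt_succ_div_le hT
  have h0 := etaStar_pos (p := p) hG hD hl
  calc D ^ 2 * (1 / (etaStar p σl G D / √((T + 1 : ℕ) : ℝ))) / T
      = (D / etaStar p σl G D) * D * (√((T + 1 : ℕ) : ℝ) / T) := by
        rw [one_div_div]
        ring
    _ ≤ (σl ^ (p / 2) * G ^ (1 - p / 2) + G) * D * (2 / √T) := by gcongr
    _ = _ := by ring

/-- The reciprocal of a minimum is at most the sum of the reciprocals, so the three entries of the
stepsize yield the three terms of the rate. The factor 4 comes from the last one: 2 from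
`tauStar_mul_le` and 2 from replacing T + 1 by T. -/
lemma rate_of_noise (hp : 1 < p) (hp2 : p ≤ 2) (hG : 0 < G) (hD : 0 < D) (hs : 0 < σs)
    (hsl : σs ≤ σl) (hL : 1 ≤ Real.log (3 / δ)) {T : ℕ} (hT : 1 ≤ T) :
    D ^ 2 / stepSize p σs σl G D δ (T + 1) / T ≤ 4 * rate p σs σl G D δ T := by
  have hl : 0 < σl := hs.trans_le hsl
  have hL0 : 0 < Real.log (3 / δ) := by linarith
  have hp0 : 0 < p := by linarith
  have hT0 : (1 : ℝ) ≤ T := by exact_mod_cast hT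
  obtain ⟨hτ, -, -, -, -⟩ := tauStar_rpow_cases (δ := δ) hp hs hl hL0
  have hφ1 := one_le_phiStar (p := p) hs hsl hL
  have hφψ : 0 ≤ phiStar p σs σl δ * psiStar p σs σl δ := by
    have := Real.log_nonneg hφ1
    unfold psiStar
    positivity
  obtain ⟨hγ, -, -⟩ := gammaStar_mul_le hG hD hφψ hL0
  obtain ⟨hlam, -, -, -⟩ := lambdaStar_mul_le hD hs hl hτ hL0
  have hη := etaStar_pos (p := p) hG hD hl.le
  have h1 := etaStar_stepsize_rate_le (p := p) hG hD hl.le hT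
  have h2 : D ^ 2 * (1 / (lambdaStar p σs σl D δ /
      (tauStar p σs σl δ * ((T + 1 : ℕ) : ℝ) ^ (1 / p)))) / T ≤
      4 * ((σs ^ (2 / p - 1) * σl ^ (2 - 2 / p)
        + σs ^ (1 / p) * σl ^ (1 - 1 / p) * Real.log (3 / δ) ^ (1 - 1 / p)) * D
      / (T : ℝ) ^ (1 - 1 / p)) := by
    have h3 := tauStar_mul_le (δ := δ) hp hp2 hD hs hl hL0
    have h4 := rpow_succ_div_le (a := 1 / p) (by positivity) ((div_le_one hp0).2 hp.le) hT
    calc _ = (tauStar p σs σl δ * (D / lambdaStar p σs σl D δ)) * D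
          * (((T + 1 : ℕ) : ℝ) ^ (1 / p) / T) := by
          rw [one_div_div]
          ring
      _ ≤ (2 * (σs ^ (2 / p - 1) * σl ^ (2 - 2 / p)
        + σs ^ (1 / p) * σl ^ (1 - 1 / p) * Real.log (3 / δ) ^ (1 - 1 / p))) * D
          * (2 / (T : ℝ) ^ (1 - 1 / p)) := by gcongr
      _ = _ := by ring
  have h3 := gammaStar_rate (p := p) (σs := σs) (σl := σl) (δ := δ) hG hD (by linarith)
  unfold stepSize
  rw [if_neg hτ.ne']
  set a := gammaStar p σs σl G D δ
  set b := etaStar p σl G D / √((T + 1 : ℕ) : ℝ)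
  set c := lambdaStar p σs σl D δ / (tauStar p σs σl δ * ((T + 1 : ℕ) : ℝ) ^ (1 / p))
  have hb : 0 < b := by positivity
  have hc : 0 < c := by positivity
  have h4 := inv_min_le (lt_min hγ hb) hc
  have h5 := inv_min_le hγ hb
  have h6 : D ^ 2 / min (min a b) c ≤ D ^ 2 * (1 / a) + D ^ 2 * (1 / b) + D ^ 2 * (1 / c) := by
    calc D ^ 2 / min (min a b) c = D ^ 2 * (1 / min (min a b) c) := by ring
      _ ≤ D ^ 2 * (1 / a + 1 / b + 1 / c) := by
          gcongr
          linarith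
      _ = _ := by ring
  calc D ^ 2 / min (min a b) c / T
      ≤ (D ^ 2 * (1 / a) + D ^ 2 * (1 / b) + D ^ 2 * (1 / c)) / T := by gcongr
    _ = D ^ 2 * (1 / a) / T + D ^ 2 * (1 / b) / T + D ^ 2 * (1 / c) / T := by ring
    _ ≤ _ := by
        rw [h3]
        unfold rate
        have e1 : 0 ≤ (phiStar p σs σl δ * psiStar p σs σl δ + Real.log (3 / δ)) * G * D / T := by
          positivity
        have e2 : 0 ≤ (σl ^ (p / 2) * G ^ (1 - p / 2) + G) * D / √T := by positivity
        linarith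

lemma phiStar_zero : phiStar p 0 0 δ = 0 := by
  simp [phiStar, dEff]

lemma tauStar_zero (hp : 1 < p) : tauStar p 0 0 δ = 0 := by
  have h : (1 / p : ℝ) ≠ 0 := by positivity
  unfold tauStar
  simp [Real.zero_rpow (by simpa using h : p⁻¹ ≠ 0)]

lemma rate_of_noiseless (hp : 1 < p) (hG : 0 < G) (hD : 0 < D)
    (hL : 1 ≤ Real.log (3 / δ)) {T : ℕ} (hT : 1 ≤ T) :
    D ^ 2 / stepSize p 0 0 G D δ (T + 1) / T ≤ 4 * rate p 0 0 G D δ T := by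
  have hL0 : 0 < Real.log (3 / δ) := by linarith
  have hT0 : (1 : ℝ) ≤ T := by exact_mod_cast hT
  have hφψ : phiStar p 0 0 δ * psiStar p 0 0 δ = 0 := by rw [phiStar_zero, zero_mul]
  obtain ⟨hγ, -, -⟩ := gammaStar_mul_le hG hD hφψ.ge hL0
  have hη := etaStar_pos (p := p) hG hD le_rfl
  have h1 := etaStar_stepsize_rate_le (p := p) hG hD le_rfl hT
  have h3 := gammaStar_rate (p := p) (σs := 0) (σl := 0) (δ := δ) hG hD (by linarith)
  unfold stepSize
  rw [if_pos (tauStar_zero hp)]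
  set a := gammaStar p 0 0 G D δ
  set b := etaStar p 0 G D / √((T + 1 : ℕ) : ℝ)
  have hb : 0 < b := by positivity
  have h5 := inv_min_le hγ hb
  calc D ^ 2 / min a b / T = D ^ 2 * (1 / min a b) / T := by ring
    _ ≤ D ^ 2 * (1 / a + 1 / b) / T := by gcongr
    _ = D ^ 2 * (1 / a) / T + D ^ 2 * (1 / b) / T := by ring
    _ ≤ _ := by
        rw [h3]
        unfold rate
        have e1 : 0 ≤ (phiStar p 0 0 δ * psiStar p 0 0 δ + Real.log (3 / δ)) * G * D / T := by
          rw [hφψ]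
          positivity
        have e2 : 0 ≤ ((0 : ℝ) ^ (p / 2) * G ^ (1 - p / 2) + G) * D / √T := by positivity
        have e3 : 0 ≤ ((0 : ℝ) ^ (2 / p - 1) * 0 ^ (2 - 2 / p)
            + 0 ^ (1 / p) * 0 ^ (1 - 1 / p) * Real.log (3 / δ) ^ (1 - 1 / p)) * D
            / (T : ℝ) ^ (1 - 1 / p) := by positivity
        linarith

end Parameters

/-! ### The schedule, with and without noise. -/

section Schedule

variable {p G D σs σl δ : ℝ}

lemma stepSize_antitone (hη : 0 ≤ etaStar p σl G D) (hp : 0 < p)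
    (hlam : 0 ≤ lambdaStar p σs σl D δ) (hτ : 0 ≤ tauStar p σs σl δ) (s t : ℕ) (hs : 1 ≤ s)
    (hst : s ≤ t) : stepSize p σs σl G D δ t ≤ stepSize p σs σl G D δ s := by
  have hs0 : (0 : ℝ) < s := by exact_mod_cast hs
  unfold stepSize
  split_ifs with h
  · gcongr
  · have : 0 < tauStar p σs σl δ := lt_of_le_of_ne hτ (Ne.symm h)
    gcongr

/-- The schedule is admissible, for suitable bounds on the moments of the clipping error, and
it leads to the claimed rate. -/
theorem exists_isAdmissible {d : ℕ} {Ξ : Type*} [MeasurableSpace Ξ]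
    {X : Set (EuclideanSpace ℝ (Fin d))}
    {f' : EuclideanSpace ℝ (Fin d) → EuclideanSpace ℝ (Fin d)}
    {g : EuclideanSpace ℝ (Fin d) → Ξ → EuclideanSpace ℝ (Fin d)}
    {P : Measure Ξ} [IsProbabilityMeasure P] (h : IsHeavyTailedOracle X f' g P p σs σl)
    (hG : 0 < G) (hf' : ∀ y ∈ X, ‖f' y‖ ≤ G) (hD : 0 < D) (hL : 1 ≤ Real.log (3 / δ)) {T : ℕ}
    (hT : 1 ≤ T) :
    (∀ t, 1 ≤ t → 0 < stepSize p σs σl G D δ t) ∧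
    (∀ s t, 1 ≤ s → s ≤ t → stepSize p σs σl G D δ t ≤ stepSize p σs σl G D δ s) ∧
    (∃ B V W : ℕ → ℝ,
      (∀ t, ClipErrorBound X f' g P (clipThreshold p σs σl G δ t) (B t) (V t) (W t)) ∧
      (∀ t, 0 ≤ B t) ∧ (∀ t, 0 ≤ V t) ∧
      IsAdmissible (stepSize p σs σl G D δ) (clipThreshold p σs σl G δ) B V W G
        (Real.log (3 / δ)) (D ^ 2 / stepSize p σs σl G D δ (T + 1)) 104 T) ∧
    D ^ 2 / stepSize p σs σl G D δ (T + 1) / T ≤ 4 * rate p σs σl G D δ T := by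
  have hp := h.one_lt_p
  have hp2 := h.p_le_two
  have hp0 : 0 < p := by linarith
  have hL0 : 0 < Real.log (3 / δ) := by linarith
  rcases h.σs_nonneg.eq_or_lt with hs | hs
  · subst hs
    -- The only use of the bound of σl by a dimension-dependent multiple of σs: it excludes σs = 0 <
    -- σl.
    have hl : σl = 0 := le_antisymm (by simpa using h.σl_le) h.σs_le_σl
    subst hl
    have hτ0 := tauStar_zero (δ := δ) hp
    have hφψ : phiStar p 0 0 δ * psiStar p 0 0 δ = 0 := by rw [phiStar_zero, zero_mul]
    obtain ⟨hγ, -, hγL⟩ := gammaStar_mul_le hG hD hφψ.ge hL0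
    have hη := etaStar_pos (p := p) hG hD le_rfl
    have hstep : ∀ t, stepSize p 0 0 G D δ t =
        min (gammaStar p 0 0 G D δ) (etaStar p 0 G D / √t) := fun t => if_pos hτ0
    have hpos : ∀ t, 1 ≤ t → 0 < stepSize p 0 0 G D δ t := fun t ht => by
      have : (0 : ℝ) < t := by exact_mod_cast ht
      rw [hstep]
      positivity
    have hclip : ∀ t, clipThreshold p 0 0 G δ t = 2 * G := fun t => by
      rw [clipThreshold, hτ0, zero_mul]
      exact max_eq_left (by positivity)
    refine ⟨hpos, stepSize_antitone hη.le hp0 ?_ hτ0.ge, ⟨0, 0, 0, fun t => ?_, fun t => le_rfl,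
      fun t => le_rfl, ?_⟩, rate_of_noiseless hp hG hD hL hT⟩
    · unfold lambdaStar
      positivity
    · rw [hclip]
      exact h.clipErrorBound_zero fun y hy => (hf' y hy).trans (by linarith)
    · exact isAdmissible_of_noiseless hG hD hL hη hγL (etaStar_mul_le hG hD le_rfl) hpos
        (fun t _ => by rw [hstep]; exact min_le_left _ _)
        (fun t _ => by rw [hstep]; exact min_le_right _ _) hclip T
  · have hsl := h.σs_le_σl
    have hl : 0 < σl := hs.trans_le hsl
    obtain ⟨hτ, hφτ, -, -, -⟩ := tauStar_rpow_cases (δ := δ) hp hs hl hL0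
    have hφ1 := one_le_phiStar (p := p) hs hsl hL
    have hφψ : 0 ≤ phiStar p σs σl δ * psiStar p σs σl δ := by
      have := Real.log_nonneg hφ1
      unfold psiStar
      positivity
    obtain ⟨hγ, hγφ, hγL⟩ := gammaStar_mul_le hG hD hφψ hL0
    obtain ⟨hlam, hlamL, hlamφ, hlamy⟩ := lambdaStar_mul_le hD hs hl hτ hL0
    have hη := etaStar_pos (p := p) hG hD hl.le
    have hstep : ∀ t, stepSize p σs σl G D δ t =
        min (min (gammaStar p σs σl G D δ) (etaStar p σl G D / √t))
          (lambdaStar p σs σl D δ / (tauStar p σs σl δ * (t : ℝ) ^ (1 / p))) := fun t =>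
      if_neg hτ.ne'
    have hpos : ∀ t, 1 ≤ t → 0 < stepSize p σs σl G D δ t := fun t ht => by
      have : (0 : ℝ) < t := by exact_mod_cast ht
      rw [hstep]
      positivity
    have hclipG : ∀ t, 2 * G ≤ clipThreshold p σs σl G δ t := fun t => le_max_left _ _
    have hclip0 : ∀ t, 0 < clipThreshold p σs σl G δ t := fun t => by linarith [hclipG t]
    refine ⟨hpos, stepSize_antitone hη.le hp0 hlam.le hτ.le,
      ⟨_, _, _, fun t => h.clipErrorBound hs hG hf' (hclipG t), fun t => ?_, fun t => ?_,
      isAdmissible_of_noise hp hp2 hG hD hL hs hsl hτ hφ1 hφτ hγ hη hlam hγφ hγL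
        (etaStar_mul_le hG hD hl.le) (etaStar_sq_mul_le hG hl.le) hlamL (hφτ ▸ hlamφ) hlamy hpos
        (stepSize_antitone hη.le hp0 hlam.le hτ.le)
        (fun t _ => by rw [hstep]; exact (min_le_left _ _).trans (min_le_left _ _))
        (fun t _ => by rw [hstep]; exact (min_le_left _ _).trans (min_le_right _ _))
        (fun t _ => by rw [hstep]; exact min_le_right _ _) (fun t => rfl) T⟩,
      rate_of_noise hp hp2 hG hD hs hsl hL hT⟩
    · have := hclip0 t
      positivity
    · have := hclip0 t
      positivity

end Schedule

/-! ### Averaging, and the theorem. -/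

section Conclusion

lemma avgIterate_gap_le {d : ℕ} {Ω : Type*} {f r : EuclideanSpace ℝ (Fin d) → ℝ}
    (hf : ConvexOn ℝ Set.univ f) (hr : ConvexOn ℝ Set.univ r)
    (x : ℕ → Ω → EuclideanSpace ℝ (Fin d)) {T : ℕ} (hT : 1 ≤ T) (ω : Ω) (m : ℝ) :
    (f (avgIterate x T ω) + r (avgIterate x T ω)) - m ≤
      (∑ t ∈ Finset.Icc 1 T, ((f (x (t + 1) ω) + r (x (t + 1) ω)) - m)) / T := by
  have hT0 : (0 : ℝ) < T := by exact_mod_cast hT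
  have h := (hf.add hr).map_sum_le (t := Finset.Icc 1 T) (w := fun _ => 1 / (T : ℝ))
    (p := fun t => x (t + 1) ω) (fun _ _ => by positivity)
    (by simp [hT0.ne']) (fun _ _ => Set.mem_univ _)
  rw [← Finset.smul_sum, ← Finset.smul_sum] at h
  simp only [Pi.add_apply, smul_eq_mul] at h
  rw [Finset.sum_sub_distrib, sub_div]
  have e : (∑ _t ∈ Finset.Icc 1 T, m) / T = m := by
    simp only [Finset.sum_const, Nat.card_Icc, add_tsub_cancel_right, nsmul_eq_mul]
    field_simp
  rw [e]
  unfold avgIterate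
  calc _ ≤ 1 / (T : ℝ) * ∑ t ∈ Finset.Icc 1 T, (f (x (t + 1) ω) + r (x (t + 1) ω)) - m := by
        gcongr
    _ = _ := by ring

end Conclusion

end StabilizedClippedSGD

theorem mainTheorem10 :
    ∃ C : ℝ, 0 < C ∧
      ∀ (d : ℕ) (X : Set (EuclideanSpace ℝ (Fin d)))
        (f r : EuclideanSpace ℝ (Fin d) → ℝ)
        (f' : EuclideanSpace ℝ (Fin d) → EuclideanSpace ℝ (Fin d))
        (xstar x₁ : EuclideanSpace ℝ (Fin d)) (G p σs σl δ : ℝ)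
        (Ξ : Type*) [MeasurableSpace Ξ] (P : Measure Ξ) [IsProbabilityMeasure P]
        (g : EuclideanSpace ℝ (Fin d) → Ξ → EuclideanSpace ℝ (Fin d))
        (Ω : Type*) [MeasurableSpace Ω] (μ : Measure Ω) [IsProbabilityMeasure μ]
        (ξ : ℕ → Ω → Ξ) (x : ℕ → Ω → EuclideanSpace ℝ (Fin d)),
        IsClosed X → Convex ℝ X →
        xstar ∈ X → IsMinOn (fun y => f y + r y) X xstar →
        ConvexOn ℝ Set.univ f → ConvexOn ℝ Set.univ r →
        (∀ y ∈ X, IsSubgradientAt f y (f' y)) →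
        0 < G → (∀ y ∈ X, ‖f' y‖ ≤ G) →
        IsHeavyTailedOracle X f' g P p σs σl →
        x₁ ∈ X → x₁ ≠ xstar →
        0 < δ → δ ≤ 1 →
        (∀ t, 1 ≤ t → Measurable (ξ t)) →
        (∀ t, 1 ≤ t → μ.map (ξ t) = P) →
        iIndepFun (fun t : ℕ => ξ (t + 1)) μ →
        IsStabilizedClippedSGD X r g x₁
          (stepSize p σs σl G ‖xstar - x₁‖ δ) (clipThreshold p σs σl G δ) ξ x →
        ∀ T : ℕ, 1 ≤ T →
          ENNReal.ofReal (1 - δ) ≤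
            μ {ω | (f (avgIterate x T ω) + r (avgIterate x T ω)) - (f xstar + r xstar)
              ≤ C * rate p σs σl G ‖xstar - x₁‖ δ T} := by
  -- This is k²/2 with k = 4A + 20 and A = 104, times the factor 4 lost in comparing D²/(η_{T+1}T)
  -- with the rate.
  refine ⟨(4 * 104 + 20) ^ 2 / 2 * 4, by norm_num, ?_⟩
  intro d X f r f' xstar x₁ G p σs σl δ Ξ _ P _ g Ω _ μ _ ξ x _ hX hstar hmin hf hr hsub hG hf' hO
    hx₁ hne hδ hδ1 hξ hP hind hx T hT
  have hD : 0 < ‖xstar - x₁‖ := norm_pos_iff.2 (sub_ne_zero.2 hne.symm)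
  have hT0 : (0 : ℝ) < T := by exact_mod_cast hT
  have hL := one_le_log_three_div hδ hδ1
  obtain ⟨hη, hη', ⟨B, V, W, hE, hB, hV, hA⟩, hrate⟩ := exists_isAdmissible hO hG hf' hD hL hT
  -- The subgradient selection is not assumed measurable; it is, being a parametric integral of the
  -- jointly measurable oracle.
  have hf'm : Measurable fun y : X => f' y := by
    have h : (fun y : X => f' y) = fun y : X => ∫ z, g y z ∂P := by
      funext y
      exact (hO.unbiased y y.2).symm
    rw [h]
    exact (StronglyMeasurable.integral_prod_right (f := fun (y : X) z => g y z)
      hO.measurable.stronglyMeasurable).measurable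
  -- The failure probability is in fact δ/3, since one exponential event suffices.
  have hexp : Real.exp (-Real.log (3 / δ)) ≤ δ := by
    rw [Real.exp_neg, Real.exp_log (by positivity), inv_div]
    linarith
  refine le_trans (ENNReal.ofReal_le_ofReal (by linarith)) ((regret_le_of_isAdmissible hX hstar
    hmin hr hsub hG hf' hf'm hO.measurable hO.integrable hx₁ hne hξ hP hind hη hη'
    (fun t _ => le_max_left _ _) (fun t _ => hE t) (fun t _ => hB t) (fun t _ => hV t) hL
    (by norm_num) hA hx).trans (measure_mono fun ω hω => ?_))
  simp only [Set.mem_ofPred_eq] at hω ⊢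
  refine (avgIterate_gap_le hf hr x hT ω _).trans ?_
  calc _ ≤ (4 * 104 + 20) ^ 2 / 2 *
        (‖xstar - x₁‖ ^ 2 / stepSize p σs σl G ‖xstar - x₁‖ δ (T + 1)) / T := by gcongr
    _ = (4 * 104 + 20) ^ 2 / 2 *
        (‖xstar - x₁‖ ^ 2 / stepSize p σs σl G ‖xstar - x₁‖ δ (T + 1) / T) := by ring
    _ ≤ (4 * 104 + 20) ^ 2 / 2 * (4 * rate p σs σl G ‖xstar - x₁‖ δ T) := by gcongr
    _ = _ := by ring
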